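/- Let $\{X_{n,i}\}_{n,i\ge1}$ be i.i.d. random variables with values in $\{0,1,2,\dots\}$ and $P(X_{1,1}=j)=a_j$, and let $\{Y_n\}_{n\ge1}$ be i.i.d. random variables with values in $\{0,1,2,\dots\}$ and $P(Y_1=j)=b_j$, the two families being independent of each other. Put $A(x)=\sum_{j\ge0}a_jx^j$, $B(x)=\sum_{j\ge0}b_jx^j$, and define the Galton–Watson process with immigration by $Z_0=0$ and $Z_n=\sum_{i=1}^{Z_{n-1}}X_{n,i}+Y_n$ for $n\ge1$. Assume condition (H): $0<a_0<1$, $0<b_0<1$, $\sum_{j\ge1}a_jj^2\log j<\infty$, $\sum_{j\ge1}b_jj^2<\infty$, $E X_{1,1}=1$, $0<\beta:=B'(1-)<\infty$ and $0<\gamma:=\tfrac12A''(1-)<\infty$. Let $\sigma=\beta/\gamma$. **Theorem 3.1.** Let $\varepsilon>0$ and, for $k\ge1$, let $$A(k,\varepsilon)=P\Big(\Big|\bar X_k+\frac{Y_1}{k}-1\Big|>\varepsilon\Big),\qquad \bar X_k=\frac1k\sum_{i=1}^kX_{1,i}.$$ Suppose that, for some $r>\sigma$ and some $C_\varepsilon>0$,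 $A(k,\varepsilon)\le C_\varepsilon k^{-r}$ for all $k\ge1$. Then the limit $$q(\varepsilon)=\lim_{n\to\infty}n^{\sigma}P\Big(\Big|\frac{Z_{n+1}}{Z_n}-1\Big|>\varepsilon\ \Big|\ Z_n>0\Big)$$ exists and is finite, and $q(\varepsilon)\geq 0$. Moreover $q(\varepsilon)>0$ if and only if the deviation event is possible at all, that is, if and only if $P\big(Z_n>0,\ |Z_{n+1}/Z_n-1|>\varepsilon\big)>0$ for some $n$. In particular, $q(\varepsilon)>0$ whenever $\varepsilon<1$. -/

import Mathlib

open MeasureTheory ProbabilityTheory Filter Topology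

noncomputable section

namespace GWI

/-- The probability generating function `x ↦ ∑ⱼ pⱼ xʲ` of a law `p` on `ℕ`. -/
def genFun (p : PMF ℕ) (x : ℝ) : ℝ := ∑' j : ℕ, (p j).toReal * x ^ j

/-- Condition (H) on the offspring law `a` (generating function `A`) and the immigration law `b`
(generating function `B`), with `β = B'(1-)` and `γ = A''(1-) / 2`. -/
structure ConditionH (a b : PMF ℕ) (β γ : ℝ) : Prop where
  a_zero_pos : 0 < (a 0).toReal
  a_zero_lt_one : (a 0).toReal < 1
  b_zero_pos : 0 < (b 0).toReal
  b_zero_lt_one : (b 0).toReal < 1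
  summable_a : Summable fun j : ℕ => (a j).toReal * (j : ℝ) ^ 2 * Real.log (j : ℝ)
  summable_b : Summable fun j : ℕ => (b j).toReal * (j : ℝ) ^ 2
  /-- Criticality: the offspring mean is `1`. -/
  mean_a : HasSum (fun j : ℕ => (j : ℝ) * (a j).toReal) 1
  beta_eq : Tendsto (deriv (genFun b)) (𝓝[<] 1) (𝓝 β)
  beta_pos : 0 < β
  gamma_eq : Tendsto (fun x : ℝ => (1 / 2) * deriv (deriv (genFun a)) x) (𝓝[<] 1) (𝓝 γ)
  gamma_pos : 0 < γ

/-- `X` and `Y` are the offspring and immigration variables of a process with offspring law `a` and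
immigration law `b`: all the `X n i` have law `a`, all the `Y n` have law `b`, and all these
variables together are independent. Indices start at `0`: `X n i` is the number of children of the
`(i+1)`-st individual of generation `n`, and `Y n` the number of immigrants entering
generation `n + 1`. -/
structure IsInput {Ω : Type*} [MeasurableSpace Ω] (P : Measure Ω) (a b : PMF ℕ)
    (X : ℕ → ℕ → Ω → ℕ) (Y : ℕ → Ω → ℕ) : Prop where
  measurable_X : ∀ n i, Measurable (X n i)
  measurable_Y : ∀ n, Measurable (Y n)
  law_X : ∀ n i, P.map (X n i) = a.toMeasure
  law_Y : ∀ n, P.map (Y n) = b.toMeasure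
  indep : iIndepFun (Sum.elim (fun p : ℕ × ℕ => X p.1 p.2) Y) P

/-- The Galton-Watson process with immigration, started from `Z₀ = 0`. -/
def Z {Ω : Type*} (X : ℕ → ℕ → Ω → ℕ) (Y : ℕ → Ω → ℕ) : ℕ → Ω → ℕ
  | 0, _ => 0
  | n + 1, ω => (∑ i ∈ Finset.range (Z X Y n ω), X n i ω) + Y n ω

/-- The average of the first `k` offspring variables of the first family. -/
def offspringMean {Ω : Type*} (X : ℕ → ℕ → Ω → ℕ) (k : ℕ) (ω : Ω) : ℝ :=
  (1 / (k : ℝ)) * ∑ i ∈ Finset.range k, (X 0 i ω : ℝ)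

/-- `A(k, ε) = P(|X̄ₖ + Y₁ / k - 1| > ε)`. -/
def devProb {Ω : Type*} [MeasurableSpace Ω] (P : Measure Ω)
    (X : ℕ → ℕ → Ω → ℕ) (Y : ℕ → Ω → ℕ) (k : ℕ) (ε : ℝ) : ℝ :=
  P.real {ω | |offspringMean X k ω + (Y 0 ω : ℝ) / (k : ℝ) - 1| > ε}

/-- The event `|Z_{n+1} / Z_n - 1| > ε` (to be used on `Z_n > 0` only). -/
def ratioDev {Ω : Type*} (X : ℕ → ℕ → Ω → ℕ) (Y : ℕ → Ω → ℕ) (n : ℕ) (ε : ℝ) : Set Ω :=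
  {ω | |(Z X Y (n + 1) ω : ℝ) / (Z X Y n ω : ℝ) - 1| > ε}

/-- The event `Z_n > 0`. -/
def alive {Ω : Type*} (X : ℕ → ℕ → Ω → ℕ) (Y : ℕ → Ω → ℕ) (n : ℕ) : Set Ω :=
  {ω | 0 < Z X Y n ω}

end GWI

end

/-! Write `p_n(k) = P(Z_n = k)`. Given `Z_n = k`, the next generation is a fresh sum of `k`
offspring variables and one immigration variable, so `P(Z_n > 0, deviation) = p_n(0) * ∑_{k ≥ 1}
(p_n(k) / p_n(0)) A(k, ε)`. The two factors are treated separately.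

Decay of `p_n(0)` (`ConditionH.exists_tendsto_rpow_mul_processLaw_zero`): with `s_n = 1 - A_n(0)`,
where `A_n` is the `n`-th iterate of `A`, one has `p_{n+1}(0) / p_n(0) = B(1 - s_n)`. Its logarithm
is `-β s_n`, that of `s_{n+1} / s_n` is `-γ s_n`, up to summable errors, the log moment of `a`
controlling the offspring remainder. So `p_n(0)` is asymptotic to a constant times `s_n^σ`, and `n
s_n → 1/γ` gives `n^σ p_n(0) → c > 0`.

Convergence of the sum (`tendsto_sum_lawRatio_mul_devProb`): `p_n(k) / p_n(0)` increases in `n` to a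
limit `μ_k` with `∑_{1 ≤ k ≤ N} μ_k = O(N^σ)`. As `A(k, ε) = O(k^(-r))` with `r > σ`, the sum `∑ μ_k
A(k, ε)` converges and dominates.

Since `p_n(0) → 0`, conditioning on `Z_n > 0` does not affect the limit, and `q = c ∑ μ_k A(k, ε)`.
By monotonicity `q` is positive exactly when one of the approximating sums is. -/

namespace GWI

/-! ### Convolution and branching of laws on `ℕ`. -/

/-- The law of the sum of two independent variables with laws `p` and `q`. -/
noncomputable def conv (p q : PMF ℕ) : PMF ℕ := p.bind fun i => q.map (i + ·)

/-- The law of the sum of `k` independent variables with law `a`. -/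
noncomputable def iidSum (a : PMF ℕ) : ℕ → PMF ℕ
  | 0 => PMF.pure 0
  | k + 1 => conv (iidSum a k) a

/-- The law of a generation whose parent generation has law `p`. -/
noncomputable def reproduce (a p : PMF ℕ) : PMF ℕ := p.bind (iidSum a)

/-- The law of the `n`-th generation of the process with immigration. -/
noncomputable def processLaw (a b : PMF ℕ) : ℕ → PMF ℕ
  | 0 => PMF.pure 0
  | n + 1 => conv (reproduce a (processLaw a b n)) b

/-- The law of the `n`-th generation of descendants of one group of immigrants. -/
noncomputable def descendantLaw (a b : PMF ℕ) : ℕ → PMF ℕ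
  | 0 => b
  | n + 1 => reproduce a (descendantLaw a b n)

lemma pure_zero_conv (p : PMF ℕ) : conv (PMF.pure 0) p = p := by
  simp only [conv, PMF.pure_bind, zero_add]
  exact PMF.map_id p

lemma conv_pure_zero (p : PMF ℕ) : conv p (PMF.pure 0) = p := by
  simp [conv, PMF.pure_map]

lemma conv_assoc (p q r : PMF ℕ) : conv (conv p q) r = conv p (conv q r) := by
  simp only [conv, PMF.bind_bind, PMF.bind_map, PMF.map_bind, PMF.map_comp, Function.comp_def,
    add_assoc]

lemma conv_comm (p q : PMF ℕ) : conv p q = conv q p := by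
  simp only [conv, PMF.map, Function.comp_def]
  rw [PMF.bind_comm]
  simp only [add_comm]

lemma iidSum_add (a : PMF ℕ) (m n : ℕ) :
    iidSum a (m + n) = conv (iidSum a m) (iidSum a n) := by
  induction n with
  | zero => simp [iidSum, conv_pure_zero]
  | succ n ih => rw [← add_assoc, iidSum, ih, conv_assoc, iidSum]

lemma reproduce_conv (a p q : PMF ℕ) :
    reproduce a (conv p q) = conv (reproduce a p) (reproduce a q) := by
  simp only [reproduce, conv, PMF.bind_bind, PMF.bind_map, PMF.map_bind, Function.comp_def]
  congr 1
  funext i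
  rw [PMF.bind_comm]
  congr 1
  funext j
  exact iidSum_add a i j

/-- Split generation `n + 1` by ancestry: the first immigrants have evolved for `n` generations, and
the later immigrants form an independent process of age `n`. -/
lemma processLaw_succ_eq_conv (a b : PMF ℕ) (n : ℕ) :
    processLaw a b (n + 1) = conv (processLaw a b n) (descendantLaw a b n) := by
  induction n with
  | zero => simp [processLaw, descendantLaw, reproduce, iidSum]
  | succ n ih =>
    conv_lhs => rw [processLaw, ih, reproduce_conv, conv_assoc]
    rw [processLaw, descendantLaw, conv_assoc, conv_comm b]

lemma map_add_apply (q : PMF ℕ) (i j : ℕ) : q.map (i + ·) (i + j) = q j := by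
  rw [PMF.map_apply, tsum_eq_single j]
  · simp
  · intro l hl
    simp [Ne.symm hl]

lemma mul_le_conv_apply (p q : PMF ℕ) (k : ℕ) : p k * q 0 ≤ conv p q k := by
  rw [conv, PMF.bind_apply]
  refine le_trans (le_of_eq ?_) (ENNReal.le_tsum k)
  rw [← map_add_apply q k 0, add_zero]

lemma conv_apply_zero (p q : PMF ℕ) : conv p q 0 = p 0 * q 0 := by
  rw [conv, PMF.bind_apply, tsum_eq_single 0]
  · rw [← map_add_apply q 0 0]
  · intro i hi
    have h : ∀ l, 0 = i + l → q l = 0 := fun l hl => absurd (by omega) hi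
    rw [PMF.map_apply, mul_eq_zero]
    refine Or.inr (ENNReal.tsum_eq_zero.2 fun l => ?_)
    split_ifs with hl
    exacts [h l hl, rfl]

/-! ### Generating functions and extinction probabilities. -/

/-- The generating function with values in `ℝ≥0∞`. -/
noncomputable def egenFun (p : PMF ℕ) (x : ENNReal) : ENNReal := ∑' j, p j * x ^ j

lemma egenFun_zero (p : PMF ℕ) : egenFun p 0 = p 0 := by
  rw [egenFun, tsum_eq_single 0]
  · simp
  · intro j hj
    simp [hj]

lemma egenFun_pure (i : ℕ) (x : ENNReal) : egenFun (PMF.pure i) x = x ^ i := by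
  rw [egenFun, tsum_eq_single i]
  · simp
  · intro j hj
    simp [hj]

lemma egenFun_bind (p : PMF ℕ) (f : ℕ → PMF ℕ) (x : ENNReal) :
    egenFun (p.bind f) x = ∑' i, p i * egenFun (f i) x := by
  simp only [egenFun, PMF.bind_apply, ← ENNReal.tsum_mul_right, ← ENNReal.tsum_mul_left, mul_assoc]
  exact ENNReal.tsum_comm

lemma egenFun_conv (p q : PMF ℕ) (x : ENNReal) :
    egenFun (conv p q) x = egenFun p x * egenFun q x := by
  simp only [conv, egenFun_bind, PMF.map, Function.comp_def, egenFun_pure]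
  rw [egenFun, ← ENNReal.tsum_mul_right]
  simp only [egenFun, pow_add, ← ENNReal.tsum_mul_left]
  refine tsum_congr fun i => tsum_congr fun j => by ring

lemma egenFun_iidSum (a : PMF ℕ) (k : ℕ) (x : ENNReal) :
    egenFun (iidSum a k) x = egenFun a x ^ k := by
  induction k with
  | zero => simp [iidSum, egenFun_pure]
  | succ k ih => rw [iidSum, egenFun_conv, ih, pow_succ]

lemma egenFun_reproduce (a p : PMF ℕ) (x : ENNReal) :
    egenFun (reproduce a p) x = egenFun p (egenFun a x) := by
  simp only [reproduce, egenFun_bind, egenFun_iidSum]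
  rfl

/-- In generation `n + j`, the immigrants of the last `j` steps contribute a copy of `Z_j`, and each
of the `Z_n` earlier individuals an independent line with generating function `A_j`. -/
lemma egenFun_processLaw_add (a b : PMF ℕ) (n j : ℕ) (x : ENNReal) :
    egenFun (processLaw a b (n + j)) x =
      egenFun (processLaw a b j) x * egenFun (processLaw a b n) ((egenFun a)^[j] x) := by
  induction j generalizing x with
  | zero => simp [processLaw, egenFun_pure]
  | succ j ih =>
    rw [← add_assoc, processLaw, egenFun_conv, egenFun_reproduce, ih, Function.iterate_succ_apply,
      processLaw, egenFun_conv, egenFun_reproduce]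
    ring

lemma toReal_egenFun_ofReal (p : PMF ℕ) {x : ℝ} (hx : 0 ≤ x) :
    (egenFun p (ENNReal.ofReal x)).toReal = genFun p x := by
  rw [egenFun, ENNReal.tsum_toReal_eq]
  · simp [genFun, hx]
  · intro j
    exact ENNReal.mul_ne_top (p.apply_ne_top j) (by simp)

lemma egenFun_le_one (p : PMF ℕ) {x : ENNReal} (hx : x ≤ 1) : egenFun p x ≤ 1 := by
  rw [← p.tsum_coe, egenFun]
  exact ENNReal.tsum_le_tsum fun j => mul_le_of_le_one_right' (pow_le_one' hx j)

lemma genFun_mem_Icc (p : PMF ℕ) {x : ℝ} (hx : x ∈ Set.Icc (0 : ℝ) 1) :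
    genFun p x ∈ Set.Icc (0 : ℝ) 1 := by
  rw [← toReal_egenFun_ofReal p hx.1]
  refine ⟨ENNReal.toReal_nonneg, ?_⟩
  exact ENNReal.toReal_le_of_le_ofReal zero_le_one
    (by simpa using egenFun_le_one p (ENNReal.ofReal_le_one.2 hx.2))

lemma ofReal_genFun (p : PMF ℕ) {x : ℝ} (hx : x ∈ Set.Icc (0 : ℝ) 1) :
    ENNReal.ofReal (genFun p x) = egenFun p (ENNReal.ofReal x) := by
  rw [← toReal_egenFun_ofReal p hx.1, ENNReal.ofReal_toReal]
  exact ne_top_of_le_ne_top ENNReal.one_ne_top (egenFun_le_one p (ENNReal.ofReal_le_one.2 hx.2))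

lemma iterate_genFun_mem_Icc (a : PMF ℕ) {x : ℝ} (hx : x ∈ Set.Icc (0 : ℝ) 1) (n : ℕ) :
    (genFun a)^[n] x ∈ Set.Icc (0 : ℝ) 1 := by
  induction n with
  | zero => simpa using hx
  | succ n ih =>
    rw [Function.iterate_succ_apply']
    exact genFun_mem_Icc a ih

lemma ofReal_iterate_genFun (a : PMF ℕ) {x : ℝ} (hx : x ∈ Set.Icc (0 : ℝ) 1) (n : ℕ) :
    ENNReal.ofReal ((genFun a)^[n] x) = (egenFun a)^[n] (ENNReal.ofReal x) := by
  induction n with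
  | zero => simp
  | succ n ih =>
    rw [Function.iterate_succ_apply', Function.iterate_succ_apply',
      ofReal_genFun a (iterate_genFun_mem_Icc a hx n), ih]

/-- The extinction probabilities satisfy `P(Z_{n+j} = 0) = P(Z_j = 0) E[A_j(0)^{Z_n}]`. -/
lemma processLaw_add_apply_zero (a b : PMF ℕ) (n j : ℕ) :
    (processLaw a b (n + j) 0).toReal =
      (processLaw a b j 0).toReal * genFun (processLaw a b n) ((genFun a)^[j] 0) := by
  have h0 : (0 : ℝ) ∈ Set.Icc (0 : ℝ) 1 := by simp
  have h := egenFun_processLaw_add a b n j 0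
  rw [egenFun_zero, egenFun_zero] at h
  rw [h, ENNReal.toReal_mul, ← toReal_egenFun_ofReal _ (iterate_genFun_mem_Icc a h0 j).1,
    ofReal_iterate_genFun a h0, ENNReal.ofReal_zero]

lemma processLaw_succ_apply_zero (a b : PMF ℕ) (n : ℕ) :
    (processLaw a b (n + 1) 0).toReal =
      (processLaw a b n 0).toReal * genFun b ((genFun a)^[n] 0) := by
  have h1 : processLaw a b 1 = b := by
    simp [processLaw, reproduce, iidSum, pure_zero_conv]
  rw [add_comm, processLaw_add_apply_zero, h1]

/-- `P(Z_n = k) / P(Z_n = 0)` is nondecreasing in `n`. -/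
lemma processLaw_ratio_le_succ (a b : PMF ℕ) (k n : ℕ)
    (h : 0 < (processLaw a b (n + 1) 0).toReal) :
    (processLaw a b n k).toReal / (processLaw a b n 0).toReal ≤
      (processLaw a b (n + 1) k).toReal / (processLaw a b (n + 1) 0).toReal := by
  -- Adding an independent variable with mass `d` at `0` keeps at least the fraction `d` of the mass
  -- at `k`, and exactly that fraction at `0`.
  have hk := mul_le_conv_apply (processLaw a b n) (descendantLaw a b n) k
  have h0 := conv_apply_zero (processLaw a b n) (descendantLaw a b n)
  rw [← processLaw_succ_eq_conv] at hk h0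
  rw [h0, ENNReal.toReal_mul] at h ⊢
  have hd : 0 < (descendantLaw a b n 0).toReal :=
    pos_of_mul_pos_right h ENNReal.toReal_nonneg
  rw [← mul_div_mul_right _ _ hd.ne', ← ENNReal.toReal_mul]
  gcongr
  exact PMF.apply_ne_top _ _

/-! ### Derivatives of generating functions at `1-`. -/

/-- General exponents `e` let one statement serve both derivatives. Truncation in `e j - 1` is
harmless because the coefficient vanishes when `e j = 0`. -/
lemma hasDerivAt_tsum_mul_pow {c : ℕ → ℝ} {e : ℕ → ℕ} (hc : ∀ j, 0 ≤ c j) (hs : Summable c)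
    (hs' : Summable fun j => c j * e j) {x : ℝ} (hx : x ∈ Set.Ioo (-1 : ℝ) 1) :
    HasDerivAt (fun x => ∑' j, c j * x ^ e j) (∑' j, c j * e j * x ^ (e j - 1)) x := by
  refine hasDerivAt_tsum_of_isPreconnected (y₀ := 0) hs' isOpen_Ioo isPreconnected_Ioo
    (g' := fun j x => c j * e j * x ^ (e j - 1)) ?_ ?_ (by simp) ?_ hx
  · intro j y _
    rw [mul_assoc]
    exact (hasDerivAt_pow (e j) y).const_mul (c j)
  · intro j y hy
    have hcj := hc j
    rw [norm_mul, norm_pow, Real.norm_of_nonneg (by positivity)]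
    exact mul_le_of_le_one_right (by positivity)
      (pow_le_one₀ (norm_nonneg _) (abs_le.2 ⟨hy.1.le, hy.2.le⟩))
  · refine Summable.of_nonneg_of_le (fun j => mul_nonneg (hc j) (by positivity)) (fun j => ?_) hs
    exact mul_le_of_le_one_right (hc j) (pow_le_one₀ le_rfl zero_le_one)

lemma tendsto_tsum_mul_pow {c : ℕ → ℝ} {e : ℕ → ℕ} (hc : ∀ j, 0 ≤ c j) (hs : Summable c) :
    Tendsto (fun x : ℝ => ∑' j, c j * x ^ e j) (𝓝[<] 1) (𝓝 (∑' j, c j)) := by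
  refine tendsto_tsum_of_dominated_convergence hs (fun j => ?_) ?_
  · have : Tendsto (fun x : ℝ => c j * x ^ e j) (𝓝 1) (𝓝 (c j * 1 ^ e j)) :=
      Continuous.tendsto (by fun_prop) 1
    simpa using this.mono_left nhdsWithin_le_nhds
  · filter_upwards [Ioo_mem_nhdsLT (show (0 : ℝ) < 1 by norm_num)] with x hx j
    rw [Real.norm_of_nonneg (mul_nonneg (hc j) (pow_nonneg hx.1.le _))]
    exact mul_le_of_le_one_right (hc j) (pow_le_one₀ hx.1.le hx.2.le)

lemma hasSum_toReal (p : PMF ℕ) : HasSum (fun j => (p j).toReal) 1 := by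
  have h := ENNReal.hasSum_toReal (f := fun j => p j) (by simp [p.tsum_coe])
  rwa [← ENNReal.tsum_toReal_eq p.apply_ne_top, p.tsum_coe, ENNReal.toReal_one] at h

lemma summable_genFun (p : PMF ℕ) {x : ℝ} (hx : x ∈ Set.Icc (0 : ℝ) 1) :
    Summable fun j => (p j).toReal * x ^ j :=
  Summable.of_nonneg_of_le (fun _ => mul_nonneg ENNReal.toReal_nonneg (pow_nonneg hx.1 _))
    (fun _ => mul_le_of_le_one_right ENNReal.toReal_nonneg (pow_le_one₀ hx.1 hx.2))
    (hasSum_toReal p).summable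

lemma deriv_genFun (p : PMF ℕ) (h1 : Summable fun j => (p j).toReal * j) {x : ℝ}
    (hx : x ∈ Set.Ioo (-1 : ℝ) 1) :
    deriv (genFun p) x = ∑' j, (p j).toReal * j * x ^ (j - 1) :=
  (hasDerivAt_tsum_mul_pow (e := fun j => j) (fun _ => ENNReal.toReal_nonneg)
    (hasSum_toReal p).summable h1 hx).deriv

lemma tendsto_deriv_genFun (p : PMF ℕ) (h1 : Summable fun j => (p j).toReal * j) :
    Tendsto (deriv (genFun p)) (𝓝[<] 1) (𝓝 (∑' j, (p j).toReal * j)) := by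
  refine (tendsto_tsum_mul_pow (e := fun j => j - 1) (fun j => by positivity) h1).congr' ?_
  filter_upwards [Ioo_mem_nhdsLT (show (-1 : ℝ) < 1 by norm_num)] with x hx
  exact (deriv_genFun p h1 hx).symm

lemma tendsto_deriv_deriv_genFun (p : PMF ℕ) (h1 : Summable fun j => (p j).toReal * j)
    (h2 : Summable fun j => (p j).toReal * j * (j - 1 : ℕ)) :
    Tendsto (deriv (deriv (genFun p))) (𝓝[<] 1)
      (𝓝 (∑' j, (p j).toReal * j * (j - 1 : ℕ))) := by
  refine (tendsto_tsum_mul_pow (e := fun j => j - 1 - 1) (fun j => by positivity) h2).congr' ?_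
  filter_upwards [Ioo_mem_nhdsLT (show (-1 : ℝ) < 1 by norm_num)] with x hx
  have h := hasDerivAt_tsum_mul_pow (e := fun j => j - 1)
    (c := fun j => (p j).toReal * j) (fun j => by positivity) h1 h2 hx
  rw [← h.deriv]
  refine Filter.EventuallyEq.deriv_eq ?_
  filter_upwards [isOpen_Ioo.mem_nhds hx] with y hy
  exact (deriv_genFun p h1 hy).symm

/-! ### Elementary bounds on `(1 - s)ʲ`. -/

section PowBounds

variable {s : ℝ}

lemma one_sub_pow_nonneg_remainder (hs : s ∈ Set.Icc (0 : ℝ) 1) (j : ℕ) :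
    0 ≤ (1 - s) ^ j - 1 + j * s := by
  have h := one_add_mul_le_pow (a := -s) (by linarith [hs.2]) j
  rw [← sub_eq_add_neg] at h
  linarith

/-- For `R_j = (1 - s)ʲ - 1 + j s` one has `R_{j+1} = (1 - s) R_j + j s²`; this recursion drives the
induction here and in `le_one_sub_pow_remainder`. -/
lemma one_sub_pow_remainder_le (hs : s ∈ Set.Icc (0 : ℝ) 1) (j : ℕ) :
    (1 - s) ^ j - 1 + j * s ≤ j * (j - 1) / 2 * s ^ 2 := by
  induction j with
  | zero => simp
  | succ j ih =>
    have h0 : (0 : ℝ) ≤ j * (j - 1) := by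
      rcases j with _ | j
      · simp
      · push_cast; rw [add_sub_cancel_right]; positivity
    have h1 : 0 ≤ (j * (j - 1) : ℝ) * s ^ 3 := mul_nonneg h0 (pow_nonneg hs.1 _)
    have h2 := mul_le_mul_of_nonneg_right ih (sub_nonneg.2 hs.2)
    rw [pow_succ (1 - s)]
    push_cast
    nlinarith

lemma le_one_sub_pow_remainder (hs : s ∈ Set.Icc (0 : ℝ) 1) (j : ℕ) :
    j * (j - 1) / 2 * s ^ 2 - (j : ℝ) ^ 3 * s ^ 3 / 6 ≤ (1 - s) ^ j - 1 + j * s := by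
  induction j with
  | zero => simp
  | succ j ih =>
    have h1 : 0 ≤ (j : ℝ) ^ 3 * s ^ 4 := by positivity
    have h3 : 0 ≤ (6 * j + 1 : ℝ) * s ^ 3 := mul_nonneg (by positivity) (pow_nonneg hs.1 _)
    have h2 := mul_le_mul_of_nonneg_right ih (sub_nonneg.2 hs.2)
    rw [pow_succ (1 - s)]
    push_cast
    nlinarith

/-- The remainder is nondecreasing in `j` and equals `s²` at `j = 2`. -/
lemma sq_le_one_sub_pow_remainder (hs : s ∈ Set.Icc (0 : ℝ) 1) {j : ℕ} (hj : 2 ≤ j) :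
    s ^ 2 ≤ (1 - s) ^ j - 1 + j * s := by
  induction j, hj using Nat.le_induction with
  | base => exact le_of_eq (by push_cast; ring)
  | succ j _ ih =>
    have h := mul_nonneg hs.1 (sub_nonneg.2
      (pow_le_one₀ (n := j) (sub_nonneg.2 hs.2) (by linarith [hs.1] : 1 - s ≤ 1)))
    rw [pow_succ (1 - s)]
    push_cast
    linarith

end PowBounds

/-! ### Expansion of generating functions near `1`. -/

/-- A law with mean `m` has `p(1 - s) = 1 - m s + ∑ⱼ pⱼ ((1 - s)ʲ - 1 + j s)`. -/
lemma hasSum_genFun_remainder (p : PMF ℕ) {m : ℝ} (hm : HasSum (fun j => (p j).toReal * j) m)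
    {s : ℝ} (hs : s ∈ Set.Icc (0 : ℝ) 1) :
    HasSum (fun j => (p j).toReal * ((1 - s) ^ j - 1 + j * s)) (genFun p (1 - s) - 1 + m * s) := by
  have h1 : HasSum (fun j => (p j).toReal * (1 - s) ^ j) (genFun p (1 - s)) :=
    (summable_genFun p ⟨by linarith [hs.2], by linarith [hs.1]⟩).hasSum
  exact ((h1.sub (hasSum_toReal p)).add (hm.mul_right s)).congr_fun (fun j => by ring)

lemma genFun_remainder_nonneg (p : PMF ℕ) {m : ℝ} (hm : HasSum (fun j => (p j).toReal * j) m)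
    {s : ℝ} (hs : s ∈ Set.Icc (0 : ℝ) 1) : 0 ≤ genFun p (1 - s) - 1 + m * s :=
  (hasSum_genFun_remainder p hm hs).nonneg fun j =>
    mul_nonneg ENNReal.toReal_nonneg (one_sub_pow_nonneg_remainder hs j)

lemma genFun_remainder_le (p : PMF ℕ) {m : ℝ} (hm : HasSum (fun j => (p j).toReal * j) m)
    (h2 : Summable fun j => (p j).toReal * (j : ℝ) ^ 2)
    {s : ℝ} (hs : s ∈ Set.Icc (0 : ℝ) 1) :
    genFun p (1 - s) - 1 + m * s ≤ (∑' j, (p j).toReal * (j : ℝ) ^ 2) * s ^ 2 := by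
  refine hasSum_le (fun j => ?_) (hasSum_genFun_remainder p hm hs) (h2.hasSum.mul_right (s ^ 2))
  rw [mul_assoc]
  refine mul_le_mul_of_nonneg_left ((one_sub_pow_remainder_le hs j).trans ?_)
    ENNReal.toReal_nonneg
  have : (0 : ℝ) ≤ j := by positivity
  gcongr
  nlinarith

lemma apply_zero_le_genFun (p : PMF ℕ) {x : ℝ} (hx : x ∈ Set.Icc (0 : ℝ) 1) :
    (p 0).toReal ≤ genFun p x := by
  simpa [genFun] using (summable_genFun p hx).le_tsum 0
    fun j _ => mul_nonneg ENNReal.toReal_nonneg (pow_nonneg hx.1 j)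

lemma mul_le_one_sub_genFun (p : PMF ℕ) {s : ℝ} (hs : s ∈ Set.Icc (0 : ℝ) 1) :
    (1 - (p 0).toReal) * s ≤ 1 - genFun p (1 - s) := by
  have h1 : HasSum (fun j => (p j).toReal * (1 - s) ^ j) (genFun p (1 - s)) :=
    (summable_genFun p ⟨by linarith [hs.2], by linarith [hs.1]⟩).hasSum
  have h2 : HasSum (fun j => (p j).toReal * s - if j = 0 then (p 0).toReal * s else 0)
      (1 * s - (p 0).toReal * s) :=
    ((hasSum_toReal p).mul_right s).sub (hasSum_ite_eq 0 _)
  rw [sub_mul]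
  refine hasSum_le (fun j => ?_) h2 ((hasSum_toReal p).sub h1)
  rcases j with _ | j
  · simp
  · have hp : (1 - s) ^ (j + 1) ≤ 1 - s :=
      pow_le_of_le_one (by linarith [hs.2]) (by linarith [hs.1]) (by simp)
    have := mul_le_mul_of_nonneg_left hp (ENNReal.toReal_nonneg (a := p (j + 1)))
    simp only [Nat.add_eq_zero_iff, one_ne_zero, and_false, if_false]
    linarith

/-! ### The offspring remainder and the log moment. -/

/-- Source of the logarithm: the terms with `n < j` form a harmonic sum, and the tail of `j / (n +
1)²` is bounded by a constant. -/
lemma sum_min_inv_le_two_add_log {j : ℕ} (hj : 1 ≤ j) (M : ℕ) :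
    ∑ n ∈ Finset.range M, min (1 / ((n : ℝ) + 1)) (j / ((n : ℝ) + 1) ^ 2) ≤ 2 + Real.log j := by
  have hj0 : (0 : ℝ) < j := by exact_mod_cast hj
  have hbase : ∑ n ∈ Finset.range j, min (1 / ((n : ℝ) + 1)) (j / ((n : ℝ) + 1) ^ 2) ≤
      1 + Real.log j := by
    refine le_trans (Finset.sum_le_sum fun n _ => min_le_left _ _) ?_
    have h := harmonic_le_one_add_log j
    simpa [harmonic] using h
  -- The extra `- j / M` makes the tail telescope in the induction.
  have hlarge : ∀ M, j ≤ M →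
      ∑ n ∈ Finset.range M, min (1 / ((n : ℝ) + 1)) (j / ((n : ℝ) + 1) ^ 2) ≤
        2 + Real.log j - j / M := by
    intro M hM
    induction M, hM using Nat.le_induction with
    | base => rw [div_self hj0.ne']; linarith
    | succ M hM ih =>
      have hM0 : (0 : ℝ) < M := by exact_mod_cast hj.trans hM
      rw [Finset.sum_range_succ]
      have h1 : (j : ℝ) / ((M : ℝ) + 1) ^ 2 ≤ j / M - j / (M + 1) := by
        rw [div_sub_div _ _ hM0.ne' (by positivity), div_le_div_iff₀ (by positivity) (by positivity)]
        nlinarith [mul_pos hj0 hM0]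
      have h2 := min_le_right (1 / ((M : ℝ) + 1)) (j / ((M : ℝ) + 1) ^ 2)
      push_cast
      linarith
  rcases le_total j M with h | h
  · exact (hlarge M h).trans (sub_le_self _ (by positivity))
  · refine le_trans (Finset.sum_le_sum_of_subset_of_nonneg (Finset.range_mono h)
      fun n _ _ => le_min (by positivity) (by positivity)) (by linarith)

/-- The third-order Taylor remainder of `(1 - s)ʲ`. -/
noncomputable def cubicRemainder (j : ℕ) (s : ℝ) : ℝ :=
  j * (j - 1) / 2 * s ^ 2 - ((1 - s) ^ j - 1 + j * s)

section CubicRemainder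

variable {s : ℝ}

lemma cubicRemainder_nonneg (hs : s ∈ Set.Icc (0 : ℝ) 1) (j : ℕ) :
    0 ≤ cubicRemainder j s :=
  sub_nonneg.2 (one_sub_pow_remainder_le hs j)

lemma cubicRemainder_le_sq (hs : s ∈ Set.Icc (0 : ℝ) 1) (j : ℕ) :
    cubicRemainder j s ≤ (j : ℝ) ^ 2 * s ^ 2 := by
  have h1 := one_sub_pow_nonneg_remainder hs j
  have h2 : (0 : ℝ) ≤ j * s ^ 2 := by positivity
  have h3 : (0 : ℝ) ≤ (j : ℝ) ^ 2 * s ^ 2 := by positivity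
  rw [cubicRemainder]
  nlinarith

lemma cubicRemainder_le_cube (hs : s ∈ Set.Icc (0 : ℝ) 1) (j : ℕ) :
    cubicRemainder j s ≤ (j : ℝ) ^ 3 * s ^ 3 := by
  have h1 := le_one_sub_pow_remainder hs j
  have h3 : (0 : ℝ) ≤ (j : ℝ) ^ 3 * s ^ 3 := mul_nonneg (by positivity) (pow_nonneg hs.1 _)
  rw [cubicRemainder]
  linarith

end CubicRemainder

section OffspringRemainder

variable {a : PMF ℕ} {γ : ℝ}

lemma hasSum_cubicRemainder (h1 : HasSum (fun j => (a j).toReal * j) 1)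
    (h2 : HasSum (fun j : ℕ => (a j).toReal * (j * (j - 1) / 2)) γ)
    {s : ℝ} (hs : s ∈ Set.Icc (0 : ℝ) 1) :
    HasSum (fun j => (a j).toReal * cubicRemainder j s)
      (γ * s ^ 2 - (genFun a (1 - s) - 1 + s)) := by
  have h := (h2.mul_right (s ^ 2)).sub (hasSum_genFun_remainder a h1 hs)
  rw [one_mul] at h
  exact h.congr_fun fun j => by rw [cubicRemainder]; ring

/-- Dominated convergence over `j`: each term divided by `s²` is at most `a_j j³ s → 0`, and at most
`a_j j²`, which is summable. -/
lemma tendsto_offspring_remainder (h1 : HasSum (fun j => (a j).toReal * j) 1)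
    (h2 : HasSum (fun j : ℕ => (a j).toReal * (j * (j - 1) / 2)) γ)
    (hsq : Summable fun j : ℕ => (a j).toReal * (j : ℝ) ^ 2)
    {s : ℕ → ℝ} (hs : ∀ n, s n ∈ Set.Ioc (0 : ℝ) 1) (hlim : Tendsto s atTop (𝓝 0)) :
    Tendsto (fun n => (γ * s n ^ 2 - (genFun a (1 - s n) - 1 + s n)) / s n ^ 2) atTop (𝓝 0) := by
  have hs' : ∀ n, s n ∈ Set.Icc (0 : ℝ) 1 := fun n => ⟨(hs n).1.le, (hs n).2⟩
  have heq : ∀ n, (γ * s n ^ 2 - (genFun a (1 - s n) - 1 + s n)) / s n ^ 2 =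
      ∑' j, (a j).toReal * cubicRemainder j (s n) / s n ^ 2 := fun n =>
    ((hasSum_cubicRemainder h1 h2 (hs' n)).div_const _).tsum_eq.symm
  simp only [heq]
  rw [← tsum_zero (α := ℝ) (β := ℕ) (L := SummationFilter.unconditional ℕ)]
  refine tendsto_tsum_of_dominated_convergence hsq (fun j => ?_) (Eventually.of_forall fun n j => ?_)
  · have h0 : Tendsto (fun n => (a j).toReal * (j : ℝ) ^ 3 * s n) atTop (𝓝 0) := by
      simpa using hlim.const_mul ((a j).toReal * (j : ℝ) ^ 3)
    refine squeeze_zero (fun n => ?_) (fun n => ?_) h0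
    · exact div_nonneg (mul_nonneg ENNReal.toReal_nonneg (cubicRemainder_nonneg (hs' n) j))
        (sq_nonneg _)
    · have hpos := (hs n).1
      rw [div_le_iff₀ (by positivity)]
      calc (a j).toReal * cubicRemainder j (s n)
          ≤ (a j).toReal * ((j : ℝ) ^ 3 * s n ^ 3) := by
            gcongr; exact cubicRemainder_le_cube (hs' n) j
        _ = _ := by ring
  · have hpos := (hs n).1
    rw [Real.norm_of_nonneg (div_nonneg (mul_nonneg ENNReal.toReal_nonneg
      (cubicRemainder_nonneg (hs' n) j)) (sq_nonneg _)), div_le_iff₀ (by positivity), mul_assoc]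
    gcongr
    exact cubicRemainder_le_sq (hs' n) j

/-- Exchange the sums: for fixed `j`, summing `cubicRemainder j (s n) / s n` over `n` costs at most
a constant times `j² (2 + log j)`, which the log moment makes summable against `a`. -/
lemma summable_offspring_remainder (h1 : HasSum (fun j => (a j).toReal * j) 1)
    (h2 : HasSum (fun j : ℕ => (a j).toReal * (j * (j - 1) / 2)) γ)
    (hsq : Summable fun j : ℕ => (a j).toReal * (j : ℝ) ^ 2)
    (hlog : Summable fun j : ℕ => (a j).toReal * (j : ℝ) ^ 2 * Real.log j)
    {s : ℕ → ℝ} (hs : ∀ n, s n ∈ Set.Ioc (0 : ℝ) 1) {C : ℝ} (hC : 1 ≤ C)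
    (hle : ∀ n : ℕ, s n ≤ C / (n + 1)) :
    Summable fun n => (γ * s n ^ 2 - (genFun a (1 - s n) - 1 + s n)) / s n := by
  have hs' : ∀ n, s n ∈ Set.Icc (0 : ℝ) 1 := fun n => ⟨(hs n).1.le, (hs n).2⟩
  have hsum : ∀ n, HasSum (fun j => (a j).toReal * cubicRemainder j (s n) / s n)
      ((γ * s n ^ 2 - (genFun a (1 - s n) - 1 + s n)) / s n) := fun n =>
    (hasSum_cubicRemainder h1 h2 (hs' n)).div_const _
  have hnn : ∀ n j, 0 ≤ (a j).toReal * cubicRemainder j (s n) / s n := fun n j =>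
    div_nonneg (mul_nonneg ENNReal.toReal_nonneg (cubicRemainder_nonneg (hs' n) j)) (hs' n).1
  have hterm : ∀ n j, cubicRemainder j (s n) / s n ≤
      (j : ℝ) ^ 2 * C ^ 2 * min (1 / ((n : ℝ) + 1)) (j / ((n : ℝ) + 1) ^ 2) := by
    intro n j
    have hpos := (hs n).1
    rw [mul_min_of_nonneg _ _ (by positivity), div_le_iff₀ hpos]
    -- Lets the single constant `C²` serve both branches of the minimum.
    have hCC : C ≤ C ^ 2 := by nlinarith
    rcases min_cases ((j : ℝ) ^ 2 * C ^ 2 * (1 / ((n : ℝ) + 1)))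
      ((j : ℝ) ^ 2 * C ^ 2 * (j / ((n : ℝ) + 1) ^ 2)) with ⟨h, -⟩ | ⟨h, -⟩ <;> rw [h]
    · calc cubicRemainder j (s n) ≤ (j : ℝ) ^ 2 * s n * s n := by
            rw [mul_assoc, ← sq]; exact cubicRemainder_le_sq (hs' n) j
        _ ≤ (j : ℝ) ^ 2 * (C ^ 2 / (n + 1)) * s n := by
            gcongr
            exact (hle n).trans (by gcongr)
        _ = _ := by ring
    · calc cubicRemainder j (s n) ≤ (j : ℝ) ^ 3 * s n ^ 2 * s n := by
            rw [mul_assoc, ← pow_succ]; exact cubicRemainder_le_cube (hs' n) j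
        _ ≤ (j : ℝ) ^ 3 * (C / (n + 1)) ^ 2 * s n := by
            gcongr
            exact hle n
        _ = _ := by field_simp
  refine summable_of_sum_range_le (c := ∑' j : ℕ, C ^ 2 *
    (2 * ((a j).toReal * (j : ℝ) ^ 2) + (a j).toReal * (j : ℝ) ^ 2 * Real.log j))
    (fun n => (hsum n).nonneg (hnn n)) fun M => ?_
  have hM : HasSum (fun j => ∑ n ∈ Finset.range M, (a j).toReal * cubicRemainder j (s n) / s n)
      (∑ n ∈ Finset.range M, (γ * s n ^ 2 - (genFun a (1 - s n) - 1 + s n)) / s n) :=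
    hasSum_sum fun n _ => hsum n
  refine hasSum_le (fun j => ?_) hM (((hsq.mul_left 2).add hlog).mul_left (C ^ 2)).hasSum
  rcases Nat.eq_zero_or_pos j with rfl | hj
  · simp [cubicRemainder]
  calc ∑ n ∈ Finset.range M, (a j).toReal * cubicRemainder j (s n) / s n
      ≤ ∑ n ∈ Finset.range M, (a j).toReal *
          ((j : ℝ) ^ 2 * C ^ 2 * min (1 / ((n : ℝ) + 1)) (j / ((n : ℝ) + 1) ^ 2)) := by
        refine Finset.sum_le_sum fun n _ => ?_
        rw [mul_div_assoc]
        exact mul_le_mul_of_nonneg_left (hterm n j) ENNReal.toReal_nonneg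
    _ = (a j).toReal * ((j : ℝ) ^ 2 * C ^ 2) *
          ∑ n ∈ Finset.range M, min (1 / ((n : ℝ) + 1)) (j / ((n : ℝ) + 1) ^ 2) := by
        rw [Finset.mul_sum]
        exact Finset.sum_congr rfl fun n _ => by ring
    _ ≤ (a j).toReal * ((j : ℝ) ^ 2 * C ^ 2) * (2 + Real.log j) := by
        gcongr
        exact sum_min_inv_le_two_add_log hj M
    _ = _ := by ring

end OffspringRemainder

/-! ### Asymptotics of real recursions. -/

/-- If `sₙ₊₁ = sₙ - γ sₙ² + eₙ` with `eₙ = o(sₙ²)` and `sₙ → 0`, then `n sₙ → 1 / γ`. -/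
lemma tendsto_nat_mul_of_quadratic_recursion {s e : ℕ → ℝ} {γ : ℝ} (hγ : 0 < γ)
    (hs : ∀ n, 0 < s n) (hlim : Tendsto s atTop (𝓝 0))
    (hrec : ∀ n, s (n + 1) = s n - γ * s n ^ 2 + e n)
    (he : Tendsto (fun n => e n / s n ^ 2) atTop (𝓝 0)) :
    Tendsto (fun n : ℕ => n * s n) atTop (𝓝 γ⁻¹) := by
  have hratio : Tendsto (fun n => s (n + 1) / s n) atTop (𝓝 1) := by
    have h : Tendsto (fun n => 1 - s n * (γ - e n / s n ^ 2)) atTop (𝓝 (1 - 0 * (γ - 0))) :=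
      tendsto_const_nhds.sub (hlim.mul (tendsto_const_nhds.sub he))
    rw [zero_mul, sub_zero] at h
    refine h.congr fun n => ?_
    have := (hs n).ne'
    rw [hrec]
    field_simp
    ring
  -- Inverting linearises the recursion: the increments of `1 / s_n` tend to `γ`, and Cesàro
  -- averaging finishes.
  have hdiff : Tendsto (fun n => (s (n + 1))⁻¹ - (s n)⁻¹) atTop (𝓝 γ) := by
    have h : Tendsto (fun n => (γ - e n / s n ^ 2) / (s (n + 1) / s n)) atTop
        (𝓝 ((γ - 0) / 1)) := (tendsto_const_nhds.sub he).div hratio one_ne_zero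
    rw [sub_zero, div_one] at h
    refine h.congr fun n => ?_
    have h0 := (hs n).ne'
    have h1 := (hs (n + 1)).ne'
    have h2 : γ * s n ^ 2 - e n = s n - s (n + 1) := by rw [hrec]; ring
    field_simp
    exact h2
  have hces := hdiff.cesaro
  simp only [Finset.sum_range_sub fun n => (s n)⁻¹] at hces
  have h0 : Tendsto (fun n : ℕ => (n : ℝ)⁻¹ * (s 0)⁻¹) atTop (𝓝 0) := by
    simpa using tendsto_inv_atTop_nhds_zero_nat.mul_const (s 0)⁻¹
  have hinv : Tendsto (fun n : ℕ => (n : ℝ)⁻¹ * (s n)⁻¹) atTop (𝓝 γ) := by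
    simpa [mul_sub] using hces.add h0
  refine (hinv.inv₀ hγ.ne').congr fun n => ?_
  rw [mul_inv, inv_inv, inv_inv]

/-- If `log (hₙ₊₁ / hₙ) = σ log (sₙ₊₁ / sₙ)` up to a summable error and `n sₙ → 1 / γ`, then `hₙ` is
asymptotic to a multiple of `n^(-σ)`. -/
lemma exists_tendsto_rpow_mul_of_summable_log {s h : ℕ → ℝ} {σ γ : ℝ} (hγ : 0 < γ)
    (hs : ∀ n, 0 < s n) (hh : ∀ n, 0 < h n)
    (hlim : Tendsto (fun n : ℕ => n * s n) atTop (𝓝 γ⁻¹))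
    (hsum : Summable fun n =>
      Real.log (h (n + 1) / h n) - σ * Real.log (s (n + 1) / s n)) :
    ∃ c : ℝ, 0 < c ∧ Tendsto (fun n : ℕ => (n : ℝ) ^ σ * h n) atTop (𝓝 c) := by
  set L : ℕ → ℝ := fun n => Real.log (h n) - σ * Real.log (s n) with hL
  have hdiff : ∀ n, Real.log (h (n + 1) / h n) - σ * Real.log (s (n + 1) / s n) =
      L (n + 1) - L n := fun n => by
    rw [Real.log_div (hh _).ne' (hh _).ne', Real.log_div (hs _).ne' (hs _).ne', hL]
    ring
  have ht := hsum.hasSum.tendsto_sum_nat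
  simp only [hdiff, Finset.sum_range_sub] at ht
  have hLlim := (ht.add_const (L 0)).rexp
  simp only [sub_add_cancel] at hLlim
  refine ⟨_, mul_pos (Real.exp_pos _) (Real.rpow_pos_of_pos (inv_pos.2 hγ) σ),
    (hLlim.mul (hlim.rpow_const (p := σ) (Or.inl (inv_pos.2 hγ).ne'))).congr fun n => ?_⟩
  rw [hL, Real.exp_sub, Real.exp_log (hh n), Real.mul_rpow (by positivity) (hs n).le, mul_comm σ,
    ← Real.rpow_def_of_pos (hs n)]
  have := (Real.rpow_pos_of_pos (hs n) σ).ne'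
  field_simp

/-- Combine `log u ≥ 1 - 1/u` with `(1 + t) u ≥ 1 - t²`; the lower bound `δ` keeps the error
quadratic in `t`. -/
lemma neg_sub_sq_div_le_log {u t δ : ℝ} (hδ : 0 < δ) (hu : δ ≤ u) (ht : 0 ≤ t) (htu : 1 - t ≤ u) :
    -t - t ^ 2 / δ ≤ Real.log u := by
  have hu0 : 0 < u := hδ.trans_le hu
  refine le_trans ?_ (Real.one_sub_inv_le_log_of_pos hu0)
  have h1 : t ^ 2 * u⁻¹ ≤ t ^ 2 / δ := by
    rw [div_eq_mul_inv]
    gcongr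
  have h2 : 0 ≤ (u - (1 - t)) * (1 + t) * u⁻¹ :=
    mul_nonneg (mul_nonneg (by linarith) (by linarith)) (inv_nonneg.2 hu0.le)
  have h3 : (u - (1 - t)) * (1 + t) * u⁻¹ = (1 + t) * (u * u⁻¹) - u⁻¹ + t ^ 2 * u⁻¹ := by ring
  rw [mul_inv_cancel₀ hu0.ne'] at h3
  linarith

/-! ### Survival probabilities and the decay of `P(Z_n = 0)`. -/

/-- The probability that the line of descent of one individual survives for `n` generations. -/
noncomputable def survival (a : PMF ℕ) (n : ℕ) : ℝ := 1 - (genFun a)^[n] 0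

lemma survival_succ (a : PMF ℕ) (n : ℕ) :
    survival a (n + 1) = 1 - genFun a (1 - survival a n) := by
  rw [survival, Function.iterate_succ_apply', survival, sub_sub_cancel]

namespace ConditionH

variable {a b : PMF ℕ} {β γ : ℝ}

lemma summable_a_sq (hH : ConditionH a b β γ) :
    Summable fun j : ℕ => (a j).toReal * (j : ℝ) ^ 2 := by
  have hlog2 : 0 < Real.log 2 := Real.log_pos one_lt_two
  refine Summable.of_norm_bounded_eventually_nat (hH.summable_a.mul_left (Real.log 2)⁻¹) ?_
  filter_upwards [eventually_ge_atTop 2] with j hj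
  have hle : Real.log 2 ≤ Real.log j := Real.log_le_log two_pos (by exact_mod_cast hj)
  rw [Real.norm_of_nonneg (by positivity), ← div_eq_inv_mul, le_div_iff₀ hlog2]
  gcongr

lemma hasSum_mul_a (hH : ConditionH a b β γ) : HasSum (fun j => (a j).toReal * (j : ℝ)) 1 := by
  simpa only [mul_comm] using hH.mean_a

/-- The hypothesis gives `β` only as a limit of derivatives at `1-`; uniqueness of limits identifies
it with the mean. `hasSum_choose_two_a` treats `γ` likewise. -/
lemma hasSum_mul_b (hH : ConditionH a b β γ) : HasSum (fun j => (b j).toReal * (j : ℝ)) β := by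
  have h1 : Summable fun j => (b j).toReal * (j : ℝ) := by
    refine Summable.of_nonneg_of_le (fun j => by positivity) (fun j => ?_) hH.summable_b
    gcongr
    exact_mod_cast Nat.le_self_pow two_ne_zero j
  rw [tendsto_nhds_unique hH.beta_eq (tendsto_deriv_genFun b h1)]
  exact h1.hasSum

lemma hasSum_choose_two_a (hH : ConditionH a b β γ) :
    HasSum (fun j : ℕ => (a j).toReal * (j * (j - 1) / 2)) γ := by
  have hcast : ∀ j : ℕ, (j : ℝ) * ((j - 1 : ℕ) : ℝ) = j * (j - 1) := fun j => by
    rcases j with _ | j <;> simp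
  have h2 : Summable fun j => (a j).toReal * (j : ℝ) * ((j - 1 : ℕ) : ℝ) := by
    refine Summable.of_nonneg_of_le (fun j => by positivity) (fun j => ?_) hH.summable_a_sq
    rw [sq, mul_assoc]
    gcongr
    omega
  have h := (tendsto_deriv_deriv_genFun a hH.hasSum_mul_a.summable h2).const_mul (1 / 2)
  rw [tendsto_nhds_unique hH.gamma_eq h]
  exact (h2.hasSum.mul_left (1 / 2)).congr_fun fun j => by rw [mul_assoc, hcast]; ring

lemma exists_two_le_a_pos (hH : ConditionH a b β γ) : ∃ k, 2 ≤ k ∧ 0 < (a k).toReal := by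
  by_contra! hcon
  have hz : ∀ j : ℕ, (a j).toReal * ((j : ℝ) * (j - 1) / 2) = 0 := fun j => by
    rcases Nat.lt_or_ge j 2 with hj | hj
    · interval_cases j <;> simp
    · rw [le_antisymm (hcon j hj) ENNReal.toReal_nonneg, zero_mul]
  have h := hH.hasSum_choose_two_a
  simp only [hz] at h
  exact hH.gamma_pos.ne' (h.unique hasSum_zero)

lemma survival_mem_Ioc (hH : ConditionH a b β γ) (n : ℕ) :
    survival a n ∈ Set.Ioc (0 : ℝ) 1 := by
  have hle : ∀ n, survival a n ≤ 1 := fun n => by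
    have := (iterate_genFun_mem_Icc a (x := 0) (by simp) n).1
    rw [survival]
    linarith
  refine ⟨?_, hle n⟩
  induction n with
  | zero => simp [survival]
  | succ n ih =>
    rw [survival_succ]
    refine lt_of_lt_of_le (mul_pos ?_ ih) (mul_le_one_sub_genFun a ⟨ih.le, hle n⟩)
    linarith [hH.a_zero_lt_one]

lemma survival_mem_Icc (hH : ConditionH a b β γ) (n : ℕ) :
    survival a n ∈ Set.Icc (0 : ℝ) 1 :=
  Set.Ioc_subset_Icc_self (hH.survival_mem_Ioc n)

/-- Any `k ≥ 2` with `a_k > 0` gives `a_k s_n² ≤ s_n - s_{n+1}`, which telescopes. This yields `s_n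
→ 0` and also absorbs the quadratic errors in `summable_log_ratio`. -/
lemma summable_survival_sq (hH : ConditionH a b β γ) : Summable fun n => survival a n ^ 2 := by
  obtain ⟨k, hk, hpos⟩ := hH.exists_two_le_a_pos
  refine summable_of_sum_range_le (c := ((a k).toReal)⁻¹ * 1) (fun n => sq_nonneg _) fun M => ?_
  have hstep : ∀ n, survival a n ^ 2 ≤
      ((a k).toReal)⁻¹ * (survival a n - survival a (n + 1)) := fun n => by
    have hs := hH.survival_mem_Icc n
    rw [← div_eq_inv_mul, le_div_iff₀ hpos, mul_comm]
    have h := le_hasSum (hasSum_genFun_remainder a hH.hasSum_mul_a hs) k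
      fun j _ => mul_nonneg ENNReal.toReal_nonneg (one_sub_pow_nonneg_remainder hs j)
    have h' := mul_le_mul_of_nonneg_left (sq_le_one_sub_pow_remainder hs hk) hpos.le
    rw [survival_succ]
    linarith
  refine (Finset.sum_le_sum fun n _ => hstep n).trans ?_
  rw [← Finset.mul_sum, Finset.sum_range_sub']
  have h0 := (hH.survival_mem_Ioc 0).2
  have hM := (hH.survival_mem_Ioc M).1
  gcongr
  linarith

lemma tendsto_survival (hH : ConditionH a b β γ) : Tendsto (survival a) atTop (𝓝 0) := by
  simpa [Real.sqrt_sq (hH.survival_mem_Icc _).1] using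
    hH.summable_survival_sq.tendsto_atTop_zero.sqrt

/-- Kolmogorov's estimate for critical processes. -/
lemma tendsto_nat_mul_survival (hH : ConditionH a b β γ) :
    Tendsto (fun n : ℕ => n * survival a n) atTop (𝓝 γ⁻¹) :=
  tendsto_nat_mul_of_quadratic_recursion hH.gamma_pos (fun n => (hH.survival_mem_Ioc n).1)
    hH.tendsto_survival (fun n => by rw [survival_succ]; ring)
    (tendsto_offspring_remainder hH.hasSum_mul_a hH.hasSum_choose_two_a hH.summable_a_sq
      hH.survival_mem_Ioc hH.tendsto_survival)

lemma exists_survival_le (hH : ConditionH a b β γ) :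
    ∃ C : ℝ, 1 ≤ C ∧ ∀ n : ℕ, survival a n ≤ C / (n + 1) := by
  obtain ⟨C, hC⟩ := (hH.tendsto_nat_mul_survival.add hH.tendsto_survival).bddAbove_range
  refine ⟨max C 1, le_max_right _ _, fun n => ?_⟩
  rw [le_div_iff₀ (by positivity)]
  refine le_trans ?_ (le_max_left C 1)
  have := hC (Set.mem_range_self n)
  linarith

lemma genFun_b_pos (hH : ConditionH a b β γ) (n : ℕ) : 0 < genFun b (1 - survival a n) := by
  have hs := hH.survival_mem_Icc n
  exact hH.b_zero_pos.trans_le (apply_zero_le_genFun b ⟨by linarith [hs.2], by linarith [hs.1]⟩)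

lemma processLaw_zero_pos (hH : ConditionH a b β γ) (n : ℕ) :
    0 < (processLaw a b n 0).toReal := by
  induction n with
  | zero => simp [processLaw]
  | succ n ih =>
    rw [processLaw_succ_apply_zero]
    have h := hH.genFun_b_pos n
    rw [survival, sub_sub_cancel] at h
    exact mul_pos ih h

/-- The exponent `β / γ` is the one that cancels the linear terms `-β s` and `-γ s` of the two
logarithms. What remains is bounded by multiples of `s²` and of `e / s`, both summable. -/
lemma summable_log_ratio (hH : ConditionH a b β γ) :
    Summable fun n => Real.log (genFun b (1 - survival a n)) -
      β / γ * Real.log (survival a (n + 1) / survival a n) := by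
  obtain ⟨C, hC, hle⟩ := hH.exists_survival_le
  have hsum := summable_offspring_remainder hH.hasSum_mul_a hH.hasSum_choose_two_a
    hH.summable_a_sq hH.summable_a hH.survival_mem_Ioc hC hle
  have hσ : 0 < β / γ := div_pos hH.beta_pos hH.gamma_pos
  have hσγ : β / γ * γ = β := div_mul_cancel₀ _ hH.gamma_pos.ne'
  have ha : 0 < 1 - (a 0).toReal := by linarith [hH.a_zero_lt_one]
  set K := ∑' j, (b j).toReal * (j : ℝ) ^ 2
  have hK : 0 ≤ K := tsum_nonneg fun j => by positivity
  have hb := hH.b_zero_pos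
  refine Summable.of_norm_bounded (((hH.summable_survival_sq.mul_left
    (K + β / γ * (γ ^ 2 / (1 - (a 0).toReal)) + β ^ 2 / (b 0).toReal))).add
      (hsum.mul_left (β / γ))) fun n => ?_
  have hs := hH.survival_mem_Ioc n
  have hs' := hH.survival_mem_Icc n
  set s := survival a n with hsdef
  set e := γ * s ^ 2 - (genFun a (1 - s) - 1 + s) with he
  have hx : 1 - s ∈ Set.Icc (0 : ℝ) 1 := ⟨by linarith [hs.2], by linarith [hs.1]⟩
  have he0 : 0 ≤ e := (hasSum_cubicRemainder hH.hasSum_mul_a hH.hasSum_choose_two_a hs').nonneg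
    fun j => mul_nonneg ENNReal.toReal_nonneg (cubicRemainder_nonneg hs' j)
  have hes : 0 ≤ e / s := div_nonneg he0 hs'.1
  have hv : survival a (n + 1) / s = 1 - γ * s + e / s := by
    rw [survival_succ, ← hsdef, he]
    field_simp [hs.1.ne']
    ring
  -- A lower bound uniform in `n`, serving as `δ` in `neg_sub_sq_div_le_log`.
  have hvlow : 1 - (a 0).toReal ≤ survival a (n + 1) / s := by
    rw [le_div_iff₀ hs.1, survival_succ]
    exact mul_le_one_sub_genFun a hs'
  have hB1 : Real.log (genFun b (1 - s)) ≤ -(β * s) + K * s ^ 2 := by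
    have h1 := Real.log_le_sub_one_of_pos (hH.genFun_b_pos n)
    have h2 := genFun_remainder_le b hH.hasSum_mul_b hH.summable_b hs'
    linarith
  have hB2 : -(β * s) - (β * s) ^ 2 / (b 0).toReal ≤ Real.log (genFun b (1 - s)) := by
    refine neg_sub_sq_div_le_log hb (apply_zero_le_genFun b hx)
      (mul_nonneg hH.beta_pos.le hs'.1) ?_
    linarith [genFun_remainder_nonneg b hH.hasSum_mul_b hs']
  have hv1 : Real.log (survival a (n + 1) / s) ≤ -(γ * s) + e / s := by
    have h1 := Real.log_le_sub_one_of_pos (ha.trans_le hvlow)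
    linarith
  have hv2 : -(γ * s) - (γ * s) ^ 2 / (1 - (a 0).toReal) ≤
      Real.log (survival a (n + 1) / s) :=
    neg_sub_sq_div_le_log ha hvlow (mul_nonneg hH.gamma_pos.le hs'.1) (by linarith)
  have hv1' := mul_le_mul_of_nonneg_left hv1 hσ.le
  have hv2' := mul_le_mul_of_nonneg_left hv2 hσ.le
  have hγs : β / γ * (γ * s) = β * s := by rw [← mul_assoc, hσγ]
  have hP : 0 ≤ K * s ^ 2 := by positivity
  have hQ : 0 ≤ β / γ * ((γ * s) ^ 2 / (1 - (a 0).toReal)) :=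
    mul_nonneg hσ.le (div_nonneg (sq_nonneg _) ha.le)
  have hR : 0 ≤ (β * s) ^ 2 / (b 0).toReal := by positivity
  have hS : 0 ≤ β / γ * (e / s) := mul_nonneg hσ.le hes
  have hexp : (K + β / γ * (γ ^ 2 / (1 - (a 0).toReal)) + β ^ 2 / (b 0).toReal) * s ^ 2 =
      K * s ^ 2 + β / γ * ((γ * s) ^ 2 / (1 - (a 0).toReal)) + (β * s) ^ 2 / (b 0).toReal := by
    ring
  rw [Real.norm_eq_abs, abs_le, hexp]
  constructor <;> linarith

/-- `n^σ P(Z_n = 0)` converges to a positive limit. -/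
theorem exists_tendsto_rpow_mul_processLaw_zero (hH : ConditionH a b β γ) :
    ∃ c : ℝ, 0 < c ∧
      Tendsto (fun n : ℕ => (n : ℝ) ^ (β / γ) * (processLaw a b n 0).toReal) atTop (𝓝 c) := by
  refine exists_tendsto_rpow_mul_of_summable_log hH.gamma_pos
    (fun n => (hH.survival_mem_Ioc n).1) hH.processLaw_zero_pos hH.tendsto_nat_mul_survival
    (hH.summable_log_ratio.congr fun n => ?_)
  rw [processLaw_succ_apply_zero, mul_div_cancel_left₀ _ (hH.processLaw_zero_pos n).ne', survival,
    sub_sub_cancel]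

end ConditionH

/-! ### From the random variables to their laws. -/

section Fibers

variable {Ω : Type*} [MeasurableSpace Ω] {P : Measure Ω}

lemma measure_eq_tsum_fiber {f : Ω → ℕ} (hf : Measurable f) {E : Set Ω} (hE : MeasurableSet E) :
    P E = ∑' k, P (f ⁻¹' {k} ∩ E) := by
  rw [← measure_iUnion, ← Set.iUnion_inter, ← Set.preimage_iUnion, Set.iUnion_of_singleton,
    Set.preimage_univ, Set.univ_inter]
  · intro i j hij
    refine Set.disjoint_left.2 fun ω hi hj => hij ?_
    rw [← show f ω = i from hi.1, ← show f ω = j from hj.1]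
  · exact fun k => (hf (measurableSet_singleton k)).inter hE

lemma measure_preimage_singleton {f : Ω → ℕ} (hf : Measurable f) {p : PMF ℕ}
    (hp : P.map f = p.toMeasure) (k : ℕ) : P (f ⁻¹' {k}) = p k := by
  rw [← Measure.map_apply hf (measurableSet_singleton k), hp,
    PMF.toMeasure_apply_singleton _ _ (measurableSet_singleton k)]

lemma measure_preimage {f : Ω → ℕ} (hf : Measurable f) {p : PMF ℕ}
    (hp : P.map f = p.toMeasure) (S : Set ℕ) : P (f ⁻¹' S) = p.toMeasure S := by
  rw [← Measure.map_apply hf S.to_countable.measurableSet, hp]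

lemma map_add_eq_toMeasure_conv {f g : Ω → ℕ} (hf : Measurable f) (hg : Measurable g)
    {p q : PMF ℕ} (hp : P.map f = p.toMeasure) (hq : P.map g = q.toMeasure)
    (hfg : IndepFun f g P) :
    P.map (fun ω => f ω + g ω) = (conv p q).toMeasure := by
  change P.map (f + g) = _
  refine Measure.ext_of_singleton fun l => ?_
  have hl := measurableSet_singleton l
  rw [Measure.map_apply (hf.add hg) hl, PMF.toMeasure_apply_singleton _ _ hl,
    measure_eq_tsum_fiber hf ((hf.add hg) hl), conv, PMF.bind_apply]
  refine tsum_congr fun i => ?_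
  have hset : f ⁻¹' {i} ∩ (f + g) ⁻¹' {l} = f ⁻¹' {i} ∩ g ⁻¹' ((i + ·) ⁻¹' {l}) := by
    ext ω
    simp only [Set.mem_inter_iff, Set.mem_preimage, Set.mem_singleton_iff, Pi.add_apply]
    constructor
    · rintro ⟨rfl, h⟩; exact ⟨rfl, h⟩
    · rintro ⟨rfl, h⟩; exact ⟨rfl, h⟩
  rw [hset, hfg.measure_inter_preimage_eq_mul _ _ (measurableSet_singleton i)
    (Set.to_countable _).measurableSet, measure_preimage_singleton hf hp, measure_preimage hg hq,
    ← PMF.toMeasure_map_apply _ _ _ (measurable_of_countable _) hl,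
    PMF.toMeasure_apply_singleton _ _ hl]

end Fibers

/-- The size of generation `n + 1` when generation `n` has `k` individuals. -/
def nextGen {Ω : Type*} (X : ℕ → ℕ → Ω → ℕ) (Y : ℕ → Ω → ℕ) (n k : ℕ) (ω : Ω) : ℕ :=
  (∑ i ∈ Finset.range k, X n i ω) + Y n ω

lemma measurable_nextGen_of {Ω : Type*} {_ : MeasurableSpace Ω} {X : ℕ → ℕ → Ω → ℕ}
    {Y : ℕ → Ω → ℕ} {n : ℕ} (k : ℕ) (hX : ∀ i, Measurable (X n i)) (hY : Measurable (Y n)) :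
    Measurable (nextGen X Y n k) :=
  (Finset.measurable_fun_sum _ fun i _ => hX i).add hY

lemma measurable_Z_of_lt {Ω : Type*} {_ : MeasurableSpace Ω} {X : ℕ → ℕ → Ω → ℕ}
    {Y : ℕ → Ω → ℕ} (n : ℕ) (hX : ∀ m < n, ∀ i, Measurable (X m i))
    (hY : ∀ m < n, Measurable (Y m)) : Measurable (Z X Y n) := by
  induction n with
  | zero => exact measurable_const
  | succ n ih =>
    have hZ := ih (fun m hm => hX m (hm.trans n.lt_succ_self))
      (fun m hm => hY m (hm.trans n.lt_succ_self))
    have h : Measurable fun p : ℕ × Ω => nextGen X Y n p.1 p.2 :=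
      measurable_from_prod_countable_right fun k =>
        measurable_nextGen_of k (hX n n.lt_succ_self) (hY n n.lt_succ_self)
    exact h.comp (hZ.prodMk measurable_id)

section InputSigma

variable {Ω : Type*} {X : ℕ → ℕ → Ω → ℕ} {Y : ℕ → Ω → ℕ}

/-- The `σ`-algebra generated by the input variables with index in `S`. -/
abbrev inputSigma (X : ℕ → ℕ → Ω → ℕ) (Y : ℕ → Ω → ℕ) (S : Set ((ℕ × ℕ) ⊕ ℕ)) :
    MeasurableSpace Ω :=
  ⨆ i ∈ S, MeasurableSpace.comap (Sum.elim (fun p : ℕ × ℕ => X p.1 p.2) Y i) inferInstance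

lemma measurable_X_inputSigma {S : Set ((ℕ × ℕ) ⊕ ℕ)} {n i : ℕ}
    (h : Sum.inl (n, i) ∈ S) : Measurable[inputSigma X Y S] (X n i) :=
  measurable_iff_comap_le.2
    (le_iSup₂_of_le (f := fun i (_ : i ∈ S) => MeasurableSpace.comap
      (Sum.elim (fun p : ℕ × ℕ => X p.1 p.2) Y i) inferInstance) _ h le_rfl)

lemma measurable_Y_inputSigma {S : Set ((ℕ × ℕ) ⊕ ℕ)} {n : ℕ}
    (h : Sum.inr n ∈ S) : Measurable[inputSigma X Y S] (Y n) :=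
  measurable_iff_comap_le.2
    (le_iSup₂_of_le (f := fun i (_ : i ∈ S) => MeasurableSpace.comap
      (Sum.elim (fun p : ℕ × ℕ => X p.1 p.2) Y i) inferInstance) _ h le_rfl)

end InputSigma

namespace IsInput

variable {Ω : Type*} [MeasurableSpace Ω] {P : Measure Ω} {a b : PMF ℕ}
  {X : ℕ → ℕ → Ω → ℕ} {Y : ℕ → Ω → ℕ}

lemma measurable_Z (hXY : IsInput P a b X Y) (n : ℕ) : Measurable (Z X Y n) :=
  measurable_Z_of_lt n (fun m _ => hXY.measurable_X m) (fun m _ => hXY.measurable_Y m)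

lemma measurable_nextGen (hXY : IsInput P a b X Y) (n k : ℕ) : Measurable (nextGen X Y n k) :=
  measurable_nextGen_of k (hXY.measurable_X n) (hXY.measurable_Y n)

lemma indepFun_of_disjoint (hXY : IsInput P a b X Y) {S T : Set ((ℕ × ℕ) ⊕ ℕ)}
    (hST : Disjoint S T) {f g : Ω → ℕ} (hf : Measurable[inputSigma X Y S] f)
    (hg : Measurable[inputSigma X Y T] g) : IndepFun f g P := by
  have hle : ∀ i, MeasurableSpace.comap (Sum.elim (fun p : ℕ × ℕ => X p.1 p.2) Y i)
      inferInstance ≤ ‹MeasurableSpace Ω› := by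
    rintro (p | n)
    · exact (hXY.measurable_X p.1 p.2).comap_le
    · exact (hXY.measurable_Y n).comap_le
  have h := indep_iSup_of_disjoint hle hXY.indep.iIndep hST
  rw [IndepFun_iff_Indep]
  exact indep_of_indep_of_le_left (indep_of_indep_of_le_right h hg.comap_le) hf.comap_le

lemma map_sum_X (hXY : IsInput P a b X Y) [IsProbabilityMeasure P] (n k : ℕ) :
    P.map (fun ω => ∑ i ∈ Finset.range k, X n i ω) = (iidSum a k).toMeasure := by
  induction k with
  | zero =>
    simp [iidSum, Measure.map_const, PMF.toMeasure_pure]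
  | succ k ih =>
    simp only [Finset.sum_range_succ]
    refine map_add_eq_toMeasure_conv
      (Finset.measurable_fun_sum _ fun i _ => hXY.measurable_X n i) (hXY.measurable_X n k) ih
      (hXY.law_X n k) ?_
    refine hXY.indepFun_of_disjoint (S := {i | ∃ m < k, i = Sum.inl (n, m)})
      (T := {Sum.inl (n, k)}) ?_ ?_ (measurable_X_inputSigma rfl)
    · rw [Set.disjoint_singleton_right]
      rintro ⟨m, hm, h⟩
      simp only [Sum.inl.injEq, Prod.mk.injEq, true_and] at h
      omega
    · exact Finset.measurable_fun_sum _ fun i hi =>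
        measurable_X_inputSigma ⟨i, Finset.mem_range.1 hi, rfl⟩

lemma map_nextGen (hXY : IsInput P a b X Y) [IsProbabilityMeasure P] (n k : ℕ) :
    P.map (nextGen X Y n k) = (conv (iidSum a k) b).toMeasure := by
  refine map_add_eq_toMeasure_conv
    (Finset.measurable_fun_sum _ fun i _ => hXY.measurable_X n i) (hXY.measurable_Y n)
    (hXY.map_sum_X n k) (hXY.law_Y n) ?_
  refine hXY.indepFun_of_disjoint (S := Set.range Sum.inl) (T := Set.range Sum.inr) ?_
    (Finset.measurable_fun_sum _ fun i _ => measurable_X_inputSigma ⟨_, rfl⟩)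
    (measurable_Y_inputSigma ⟨_, rfl⟩)
  exact Set.isCompl_range_inl_range_inr.disjoint

lemma indepFun_Z_nextGen (hXY : IsInput P a b X Y) (n k : ℕ) :
    IndepFun (Z X Y n) (nextGen X Y n k) P := by
  -- `Sum.elim Prod.fst id` reads off the generation of an input: `Z_n` uses only those before `n`,
  -- the next step only those of `n`.
  refine hXY.indepFun_of_disjoint (S := {i | Sum.elim Prod.fst id i < n})
    (T := {i | Sum.elim Prod.fst id i = n}) ?_ ?_ ?_
  · exact Set.disjoint_left.2 fun i (hi : _ < n) (hi' : _ = n) => hi.ne hi'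
  · exact measurable_Z_of_lt n (fun m hm i => measurable_X_inputSigma hm)
      (fun m hm => measurable_Y_inputSigma hm)
  · exact measurable_nextGen_of k (fun i => measurable_X_inputSigma (Eq.refl n))
      (measurable_Y_inputSigma (Eq.refl n))

lemma map_Z (hXY : IsInput P a b X Y) [IsProbabilityMeasure P] (n : ℕ) :
    P.map (Z X Y n) = (processLaw a b n).toMeasure := by
  induction n with
  | zero =>
    change P.map (fun _ => 0) = _
    simp [processLaw, Measure.map_const, PMF.toMeasure_pure]
  | succ n ih =>
    refine Measure.ext_of_singleton fun l => ?_
    have hl := measurableSet_singleton l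
    rw [Measure.map_apply (hXY.measurable_Z _) hl, PMF.toMeasure_apply_singleton _ _ hl,
      measure_eq_tsum_fiber (hXY.measurable_Z n) (hXY.measurable_Z (n + 1) hl), processLaw,
      reproduce, conv, PMF.bind_bind, PMF.bind_apply]
    refine tsum_congr fun k => ?_
    have hset : Z X Y n ⁻¹' {k} ∩ Z X Y (n + 1) ⁻¹' {l} =
        Z X Y n ⁻¹' {k} ∩ nextGen X Y n k ⁻¹' {l} := by
      ext ω
      constructor <;> rintro ⟨rfl, h⟩ <;> exact ⟨rfl, h⟩
    rw [hset, (hXY.indepFun_Z_nextGen n k).measure_inter_preimage_eq_mul _ _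
      (measurableSet_singleton k) hl, measure_preimage_singleton (hXY.measurable_Z n) ih,
      measure_preimage_singleton (hXY.measurable_nextGen n k) (hXY.map_nextGen n k)]
    rfl

lemma devProb_eq (hXY : IsInput P a b X Y) [IsProbabilityMeasure P] (k : ℕ) (ε : ℝ) :
    devProb P X Y k ε =
      ((conv (iidSum a k) b).toMeasure {l : ℕ | |(l : ℝ) / k - 1| > ε}).toReal := by
  rw [devProb, measureReal_def,
    ← measure_preimage (hXY.measurable_nextGen 0 k) (hXY.map_nextGen 0 k)]
  congr 2
  ext ω
  simp only [Set.mem_ofPred_eq, Set.mem_preimage, nextGen, offspringMean]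
  rw [one_div_mul_eq_div, ← add_div]
  push_cast
  rfl

lemma measure_alive_inter_ratioDev (hXY : IsInput P a b X Y) [IsProbabilityMeasure P]
    (n : ℕ) (ε : ℝ) :
    P (alive X Y n ∩ ratioDev X Y n ε) = ∑' k : ℕ, if k = 0 then 0 else
      processLaw a b n k *
        (conv (iidSum a k) b).toMeasure {l : ℕ | |(l : ℝ) / k - 1| > ε} := by
  have hset : alive X Y n ∩ ratioDev X Y n ε = (fun ω => (Z X Y n ω, Z X Y (n + 1) ω)) ⁻¹'
      {p : ℕ × ℕ | 0 < p.1 ∧ |(p.2 : ℝ) / p.1 - 1| > ε} := rfl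
  have hmeas : MeasurableSet (alive X Y n ∩ ratioDev X Y n ε) := by
    rw [hset]
    exact ((hXY.measurable_Z n).prodMk (hXY.measurable_Z (n + 1)))
      (Set.to_countable _).measurableSet
  rw [measure_eq_tsum_fiber (hXY.measurable_Z n) hmeas]
  refine tsum_congr fun k => ?_
  split_ifs with hk
  · convert measure_empty (μ := P)
    refine Set.eq_empty_of_forall_notMem ?_
    rintro ω ⟨hω, hpos, -⟩
    exact (show 0 < Z X Y n ω from hpos).ne' (hk ▸ hω)
  · have h : Z X Y n ⁻¹' {k} ∩ (alive X Y n ∩ ratioDev X Y n ε) =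
        Z X Y n ⁻¹' {k} ∩ nextGen X Y n k ⁻¹' {l : ℕ | |(l : ℝ) / k - 1| > ε} := by
      ext ω
      constructor
      · rintro ⟨rfl, -, h⟩
        exact ⟨rfl, h⟩
      · rintro ⟨rfl, h⟩
        exact ⟨rfl, Nat.pos_of_ne_zero hk, h⟩
    rw [h, (hXY.indepFun_Z_nextGen n k).measure_inter_preimage_eq_mul _ _
      (measurableSet_singleton k) (Set.to_countable _).measurableSet,
      measure_preimage_singleton (hXY.measurable_Z n) (hXY.map_Z n),
      measure_preimage (hXY.measurable_nextGen n k) (hXY.map_nextGen n k)]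

lemma measureReal_alive_inter_ratioDev (hXY : IsInput P a b X Y) [IsProbabilityMeasure P]
    (n : ℕ) (ε : ℝ) :
    P.real (alive X Y n ∩ ratioDev X Y n ε) = ∑' k : ℕ, if k = 0 then 0 else
      (processLaw a b n k).toReal * devProb P X Y k ε := by
  rw [measureReal_def, hXY.measure_alive_inter_ratioDev, ENNReal.tsum_toReal_eq]
  · refine tsum_congr fun k => ?_
    split_ifs
    · rfl
    · rw [ENNReal.toReal_mul, hXY.devProb_eq]
  · intro k
    split_ifs
    · simp
    · exact ENNReal.mul_ne_top (PMF.apply_ne_top _ _) (measure_ne_top _ _)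

lemma measureReal_alive (hXY : IsInput P a b X Y) [IsProbabilityMeasure P] (n : ℕ) :
    P.real (alive X Y n) = 1 - (processLaw a b n 0).toReal := by
  have hset : alive X Y n = (Z X Y n ⁻¹' {0})ᶜ := by
    ext ω
    simp [alive, Nat.pos_iff_ne_zero]
  rw [hset, probReal_compl_eq_one_sub (hXY.measurable_Z n (measurableSet_singleton 0)),
    measureReal_def, measure_preimage_singleton (hXY.measurable_Z n) (hXY.map_Z n)]

end IsInput

/-! ### The invariant measure and its growth. -/

/-- The ratio `P(Z_n = k) / P(Z_n = 0)`. -/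
noncomputable def lawRatio (a b : PMF ℕ) (n k : ℕ) : ℝ :=
  (processLaw a b n k).toReal / (processLaw a b n 0).toReal

/-- The invariant measure of the process, normalized to have mass `1` at `0`. -/
noncomputable def invariantMass (a b : PMF ℕ) (k : ℕ) : ℝ := ⨆ n, lawRatio a b n k

lemma lawRatio_nonneg (a b : PMF ℕ) (n k : ℕ) : 0 ≤ lawRatio a b n k :=
  div_nonneg ENNReal.toReal_nonneg ENNReal.toReal_nonneg

lemma antitone_processLaw_zero (a b : PMF ℕ) :
    Antitone fun n => (processLaw a b n 0).toReal :=
  antitone_nat_of_succ_le fun n => by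
    rw [processLaw_succ_apply_zero]
    exact mul_le_of_le_one_right ENNReal.toReal_nonneg
      (genFun_mem_Icc b (iterate_genFun_mem_Icc a (by simp) n)).2

namespace ConditionH

variable {a b : PMF ℕ} {β γ : ℝ}

lemma monotone_lawRatio (hH : ConditionH a b β γ) (k : ℕ) :
    Monotone fun n => lawRatio a b n k :=
  monotone_nat_of_le_succ fun n => processLaw_ratio_le_succ a b k n (hH.processLaw_zero_pos _)

/-- From `P(Z_j = 0) E[A_j(0)^{Z_n}] = P(Z_{n+j} = 0) ≤ P(Z_n = 0)`. The bound does not depend on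
`n`, hence survives the limit. -/
lemma sum_lawRatio_mul_pow_le (hH : ConditionH a b β γ) (n j : ℕ) (s : Finset ℕ) :
    ∑ k ∈ s, lawRatio a b n k * (1 - survival a j) ^ k ≤ ((processLaw a b j 0).toReal)⁻¹ := by
  have hx := iterate_genFun_mem_Icc a (x := 0) (by simp) j
  have hn := hH.processLaw_zero_pos n
  have hj := hH.processLaw_zero_pos j
  have h1 : ∑ k ∈ s, (processLaw a b n k).toReal * (1 - survival a j) ^ k ≤
      genFun (processLaw a b n) ((genFun a)^[j] 0) := by
    rw [survival, sub_sub_cancel]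
    exact (summable_genFun _ hx).sum_le_tsum s
      fun k _ => mul_nonneg ENNReal.toReal_nonneg (pow_nonneg hx.1 k)
  have h2 := processLaw_add_apply_zero a b n j
  have h3 := antitone_processLaw_zero a b (Nat.le_add_right n j)
  simp only at h3
  rw [h2] at h3
  simp only [lawRatio, div_mul_eq_mul_div]
  rw [← Finset.sum_div, div_le_iff₀ hn, ← div_eq_inv_mul, le_div_iff₀ hj]
  refine le_trans ?_ h3
  rw [mul_comm]
  gcongr

/-- The invariant measure of `[1, N]` is `O(N^σ)`, uniformly along the approximating sequence. -/
lemma exists_sum_lawRatio_le (hH : ConditionH a b β γ) :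
    ∃ C : ℝ, ∀ᶠ N : ℕ in atTop, ∀ n,
      ∑ k ∈ Finset.Icc 1 N, lawRatio a b n k ≤ C * (N : ℝ) ^ (β / γ) := by
  obtain ⟨C₀, hC₀, hsurv⟩ := hH.exists_survival_le
  obtain ⟨c, hc, hlim⟩ := hH.exists_tendsto_rpow_mul_processLaw_zero
  -- At time `j = M N` this gives `N s_j ≤ 1/2`, so `(1 - s_j)^k ≥ 1/2` for all `k ≤ N`, while `1 /
  -- P(Z_j = 0)` is still `O(N^σ)`.
  set M := ⌈2 * C₀⌉₊ with hM
  have hMle : 2 * C₀ ≤ M := Nat.le_ceil _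
  have hM1 : 1 ≤ M := by
    have : (1 : ℝ) ≤ M := by linarith
    exact_mod_cast this
  have hev : ∀ᶠ N : ℕ in atTop,
      c / 2 < ((M * N : ℕ) : ℝ) ^ (β / γ) * (processLaw a b (M * N) 0).toReal :=
    (tendsto_id.const_mul_atTop' (Nat.pos_of_ne_zero (by omega) : 0 < M)).eventually
      (hlim.eventually_const_lt (half_lt_self hc))
  refine ⟨2 * (2 / c * (M : ℝ) ^ (β / γ)), ?_⟩
  filter_upwards [hev, eventually_ge_atTop 1] with N hN hN1 n
  have hN0 : (0 : ℝ) < N := by exact_mod_cast hN1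
  have hj := hH.processLaw_zero_pos (M * N)
  have hs := hH.survival_mem_Icc (M * N)
  have hsle : N * survival a (M * N) ≤ 1 / 2 := by
    have h := hsurv (M * N)
    rw [le_div_iff₀ (by positivity)] at h
    push_cast at h
    have h1 : 2 * C₀ * (N * survival a (M * N)) ≤ M * (N * survival a (M * N)) :=
      mul_le_mul_of_nonneg_right hMle (mul_nonneg hN0.le hs.1)
    have h2 : C₀ * (2 * (N * survival a (M * N))) ≤ C₀ * 1 := by nlinarith [hs.1]
    linarith [le_of_mul_le_mul_left h2 (by linarith)]
  have hpow : ∀ k ∈ Finset.Icc 1 N, 1 / 2 ≤ (1 - survival a (M * N)) ^ k := fun k hk => by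
    have h1 := one_sub_pow_nonneg_remainder hs N
    exact le_trans (by linarith) (pow_le_pow_of_le_one (by linarith [hs.2]) (by linarith [hs.1])
      (Finset.mem_Icc.1 hk).2)
  have hinv : ((processLaw a b (M * N) 0).toReal)⁻¹ ≤
      2 / c * (M : ℝ) ^ (β / γ) * (N : ℝ) ^ (β / γ) := by
    rw [Nat.cast_mul, Real.mul_rpow (by positivity) (by positivity)] at hN
    rw [inv_le_iff_one_le_mul₀ hj]
    have := mul_le_mul_of_nonneg_left hN.le (by positivity : 0 ≤ 2 / c)
    rw [div_mul_div_cancel₀ hc.ne', div_self two_ne_zero] at this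
    linarith
  have hsum := hH.sum_lawRatio_mul_pow_le n (M * N) (Finset.Icc 1 N)
  have hhalf : ∑ k ∈ Finset.Icc 1 N, lawRatio a b n k * (1 / 2) ≤
      ∑ k ∈ Finset.Icc 1 N, lawRatio a b n k * (1 - survival a (M * N)) ^ k :=
    Finset.sum_le_sum fun k hk =>
      mul_le_mul_of_nonneg_left (hpow k hk) (lawRatio_nonneg a b n k)
  rw [← Finset.sum_mul] at hhalf
  linarith

lemma bddAbove_lawRatio (hH : ConditionH a b β γ) {k : ℕ} (hk : 1 ≤ k) :
    BddAbove (Set.range fun n => lawRatio a b n k) := by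
  obtain ⟨C, hC⟩ := hH.exists_sum_lawRatio_le
  obtain ⟨N, hN, hkN⟩ := (hC.and (eventually_ge_atTop k)).exists
  refine ⟨C * (N : ℝ) ^ (β / γ), ?_⟩
  rintro _ ⟨n, rfl⟩
  exact (Finset.single_le_sum (fun k _ => lawRatio_nonneg a b n k)
    (Finset.mem_Icc.2 ⟨hk, hkN⟩)).trans (hN n)

lemma tendsto_lawRatio (hH : ConditionH a b β γ) {k : ℕ} (hk : 1 ≤ k) :
    Tendsto (fun n => lawRatio a b n k) atTop (𝓝 (invariantMass a b k)) :=
  tendsto_atTop_ciSup (hH.monotone_lawRatio k) (hH.bddAbove_lawRatio hk)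

lemma lawRatio_le_invariantMass (hH : ConditionH a b β γ) {k : ℕ} (hk : 1 ≤ k) (n : ℕ) :
    lawRatio a b n k ≤ invariantMass a b k :=
  le_ciSup (hH.bddAbove_lawRatio hk) n

/-- Partial sums of order `N^σ` make the Dirichlet series of the invariant measure converge
absolutely at the real point `r > σ`. -/
lemma summable_invariantMass_mul_rpow (hH : ConditionH a b β γ) {r : ℝ} (hr : β / γ < r) :
    Summable fun k : ℕ => if k = 0 then 0 else invariantMass a b k * (k : ℝ) ^ (-r) := by
  obtain ⟨C, hC⟩ := hH.exists_sum_lawRatio_le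
  have hnn : ∀ k, 0 ≤ invariantMass a b k := fun k =>
    Real.iSup_nonneg fun n => lawRatio_nonneg a b n k
  have hO : (fun N : ℕ => ∑ k ∈ Finset.Icc 1 N, invariantMass a b k) =O[atTop]
      fun N => (N : ℝ) ^ (β / γ) := by
    refine Asymptotics.IsBigO.of_bound C ?_
    filter_upwards [hC] with N hN
    rw [Real.norm_of_nonneg (Finset.sum_nonneg fun k _ => hnn k),
      Real.norm_of_nonneg (by positivity)]
    exact le_of_tendsto' (tendsto_finsetSum _ fun k hk =>
      hH.tendsto_lawRatio (Finset.mem_Icc.1 hk).1) hN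
  have h := (LSeriesSummable_of_sum_norm_bigO_and_nonneg hO hnn
    (div_pos hH.beta_pos hH.gamma_pos).le (s := r) (by simpa using hr)).norm
  refine h.congr fun k => ?_
  rw [LSeries.norm_term_eq]
  split_ifs
  · rfl
  · rw [Complex.norm_real, Real.norm_of_nonneg (hnn k), Complex.ofReal_re,
      Real.rpow_neg (by positivity), div_eq_mul_inv]

end ConditionH

/-! ### The deviation probabilities. -/

section Deviation

variable {Ω : Type*} [MeasurableSpace Ω] {P : Measure Ω} {a b : PMF ℕ}
  {β γ : ℝ} {X : ℕ → ℕ → Ω → ℕ} {Y : ℕ → Ω → ℕ} {ε r C : ℝ}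

lemma tendsto_sum_lawRatio_mul_devProb (hH : ConditionH a b β γ) (hr : β / γ < r)
    (hC : ∀ k : ℕ, 1 ≤ k → devProb P X Y k ε ≤ C * (k : ℝ) ^ (-r)) :
    Summable (fun k => if k = 0 then 0 else invariantMass a b k * devProb P X Y k ε) ∧
    Tendsto (fun n => ∑' k, if k = 0 then 0 else lawRatio a b n k * devProb P X Y k ε) atTop
      (𝓝 (∑' k, if k = 0 then 0 else invariantMass a b k * devProb P X Y k ε)) := by
  have hdev : ∀ k, 0 ≤ devProb P X Y k ε := fun k => measureReal_nonneg
  have hnn : ∀ k, 0 ≤ invariantMass a b k := fun k =>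
    Real.iSup_nonneg fun n => lawRatio_nonneg a b n k
  have hsum : Summable fun k => if k = 0 then 0 else invariantMass a b k * devProb P X Y k ε := by
    refine Summable.of_nonneg_of_le (fun k => ?_) (fun k => ?_)
      ((hH.summable_invariantMass_mul_rpow hr).mul_left C)
    · split_ifs
      exacts [le_rfl, mul_nonneg (hnn k) (hdev k)]
    · split_ifs with hk
      · simp
      · rw [mul_left_comm]
        exact mul_le_mul_of_nonneg_left (hC k (Nat.pos_of_ne_zero hk)) (hnn k)
  refine ⟨hsum, tendsto_tsum_of_dominated_convergence hsum (fun k => ?_)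
    (Eventually.of_forall fun n k => ?_)⟩
  · split_ifs with hk
    · exact tendsto_const_nhds
    · exact (hH.tendsto_lawRatio (Nat.pos_of_ne_zero hk)).mul_const _
  · split_ifs with hk
    · simp
    · rw [Real.norm_of_nonneg (mul_nonneg (lawRatio_nonneg a b n k) (hdev k))]
      exact mul_le_mul_of_nonneg_right
        (hH.lawRatio_le_invariantMass (Nat.pos_of_ne_zero hk) n) (hdev k)

lemma IsInput.measureReal_alive_inter_ratioDev_eq_mul [IsProbabilityMeasure P]
    (hXY : IsInput P a b X Y) (hH : ConditionH a b β γ) (n : ℕ) :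
    P.real (alive X Y n ∩ ratioDev X Y n ε) = (processLaw a b n 0).toReal *
      ∑' k, if k = 0 then 0 else lawRatio a b n k * devProb P X Y k ε := by
  rw [hXY.measureReal_alive_inter_ratioDev, ← tsum_mul_left]
  refine tsum_congr fun k => ?_
  split_ifs
  · simp
  · rw [← mul_assoc, lawRatio, mul_div_cancel₀ _ (hH.processLaw_zero_pos n).ne']

/-- The first generation has some size `k ≥ 1` with positive probability; with probability `a_0^k
b_0 > 0` the next one is then empty, and the ratio `0` deviates by `1 > ε`. -/
lemma IsInput.exists_measure_pos_of_lt_one [IsProbabilityMeasure P]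
    (hXY : IsInput P a b X Y) (hH : ConditionH a b β γ) (hε : ε < 1) : ∃ n : ℕ, 0 < P (alive X Y n ∩ ratioDev X Y n ε) := by
  obtain ⟨k, hk, hbk⟩ : ∃ k, k ≠ 0 ∧ b k ≠ 0 := by
    by_contra! hcon
    have h := b.tsum_coe
    rw [tsum_eq_single 0 hcon] at h
    have := hH.b_zero_lt_one
    simp [h] at this
  have hlaw : processLaw a b 1 = b := by
    simp [processLaw, reproduce, iidSum, pure_zero_conv]
  refine ⟨1, ?_⟩
  rw [hXY.measure_alive_inter_ratioDev, hlaw]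
  refine lt_of_lt_of_le ?_ (ENNReal.le_tsum k)
  rw [if_neg hk]
  refine ENNReal.mul_pos hbk (ne_of_gt (lt_of_lt_of_le ?_ (measure_mono (s := {0}) ?_)))
  · have h0 : ∀ {p : PMF ℕ}, 0 < (p 0).toReal → p 0 ≠ 0 := fun h h' => by simp [h'] at h
    rw [PMF.toMeasure_apply_singleton _ _ (measurableSet_singleton 0), conv_apply_zero,
      ← egenFun_zero (iidSum a k), egenFun_iidSum, egenFun_zero]
    exact ENNReal.mul_pos (pow_ne_zero _ (h0 hH.a_zero_pos)) (h0 hH.b_zero_pos)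
  · simpa using hε

end Deviation

end GWI

theorem theorem3p1 {Ω : Type*} [MeasurableSpace Ω] (P : Measure Ω) [IsProbabilityMeasure P]
    (a b : PMF ℕ) (β γ : ℝ) (hH : GWI.ConditionH a b β γ)
    (X : ℕ → ℕ → Ω → ℕ) (Y : ℕ → Ω → ℕ) (hXY : GWI.IsInput P a b X Y)
    (ε : ℝ) (hε : 0 < ε) (r : ℝ) (hr : β / γ < r)
    (hA : ∃ C : ℝ, 0 < C ∧ ∀ k : ℕ, 1 ≤ k → GWI.devProb P X Y k ε ≤ C * (k : ℝ) ^ (-r)) :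
    ∃ q : ℝ,
      Tendsto (fun n : ℕ => (n : ℝ) ^ (β / γ) *
        (P[|GWI.alive X Y n]).real (GWI.ratioDev X Y n ε)) atTop (𝓝 q) ∧
      0 ≤ q ∧
      (0 < q ↔ ∃ n : ℕ, 0 < P (GWI.alive X Y n ∩ GWI.ratioDev X Y n ε)) ∧
      (ε < 1 → 0 < q) := by
  obtain ⟨C, -, hC⟩ := hA
  obtain ⟨c, hc, hlim⟩ := hH.exists_tendsto_rpow_mul_processLaw_zero
  obtain ⟨hsum, hS⟩ := GWI.tendsto_sum_lawRatio_mul_devProb hH hr hC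
  set T : ℕ → ℝ := fun n => ∑' k, if k = 0 then 0 else
    GWI.lawRatio a b n k * GWI.devProb P X Y k ε
  set S : ℝ := ∑' k, if k = 0 then 0 else
    GWI.invariantMass a b k * GWI.devProb P X Y k ε
  have hdev : ∀ k, 0 ≤ GWI.devProb P X Y k ε := fun k => measureReal_nonneg
  have hT0 : ∀ n k, 0 ≤ if k = 0 then 0 else
      GWI.lawRatio a b n k * GWI.devProb P X Y k ε := fun n k => by
    split_ifs
    exacts [le_rfl, mul_nonneg (GWI.lawRatio_nonneg a b n k) (hdev k)]
  have hTS : ∀ n, T n ≤ S := fun n => by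
    have hle : ∀ k, (if k = 0 then 0 else GWI.lawRatio a b n k * GWI.devProb P X Y k ε) ≤
        if k = 0 then 0 else GWI.invariantMass a b k * GWI.devProb P X Y k ε := fun k => by
      split_ifs with hk
      · exact le_rfl
      · exact mul_le_mul_of_nonneg_right
          (hH.lawRatio_le_invariantMass (Nat.pos_of_ne_zero hk) n) (hdev k)
    exact (Summable.of_nonneg_of_le (hT0 n) hle hsum).tsum_le_tsum hle hsum
  have hS0 : 0 ≤ S := (tsum_nonneg (hT0 0)).trans (hTS 0)
  have hreal : ∀ n, P.real (GWI.alive X Y n ∩ GWI.ratioDev X Y n ε) =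
      (GWI.processLaw a b n 0).toReal * T n :=
    hXY.measureReal_alive_inter_ratioDev_eq_mul hH
  have hpos : ∀ n, 0 < P (GWI.alive X Y n ∩ GWI.ratioDev X Y n ε) ↔ 0 < T n := fun n => by
    rw [← mul_pos_iff_of_pos_left (hH.processLaw_zero_pos n), ← hreal, measureReal_def,
      ENNReal.toReal_pos_iff, and_iff_left (measure_lt_top _ _)]
  -- If `S > 0`, some `T n > 0` because `T n → S`; conversely `T n ≤ S`.
  have hq : 0 < c * S ↔ ∃ n : ℕ, 0 < P (GWI.alive X Y n ∩ GWI.ratioDev X Y n ε) := by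
    simp only [hpos, mul_pos_iff_of_pos_left hc]
    exact ⟨fun h => (hS.eventually_const_lt h).exists, fun ⟨n, hn⟩ => hn.trans_le (hTS n)⟩
  have hσ : 0 < β / γ := div_pos hH.beta_pos hH.gamma_pos
  have hzero : Tendsto (fun n => (GWI.processLaw a b n 0).toReal) atTop (𝓝 0) := by
    have h := hlim.mul ((tendsto_rpow_neg_atTop hσ).comp tendsto_natCast_atTop_atTop)
    rw [mul_zero] at h
    refine h.congr' ?_
    filter_upwards [eventually_gt_atTop 0] with n hn
    have hn0 : (0 : ℝ) < n := by exact_mod_cast hn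
    rw [Function.comp_apply, mul_right_comm, ← Real.rpow_add hn0, add_neg_cancel, Real.rpow_zero,
      one_mul]
  refine ⟨c * S, ?_, mul_nonneg hc.le hS0, hq,
    fun h => hq.2 (hXY.exists_measure_pos_of_lt_one hH h)⟩
  have h := (hlim.mul hS).div (tendsto_const_nhds.sub hzero)
    (by norm_num : (1 : ℝ) - 0 ≠ 0)
  rw [sub_zero, div_one] at h
  -- The identity also holds at `n = 0`, where `P(Z_0 > 0) = 0`: both quotients then take the
  -- default value `0`.
  refine h.congr fun n => ?_
  have hmeas : MeasurableSet (GWI.alive X Y n) :=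
    hXY.measurable_Z n (Set.to_countable {k | 0 < k}).measurableSet
  rw [measureReal_def (P[|GWI.alive X Y n]), cond_apply hmeas, ENNReal.toReal_mul,
    ENNReal.toReal_inv, ← measureReal_def, ← measureReal_def, hreal, hXY.measureReal_alive,
    Pi.div_apply]
  ring
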